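/- Let $k\ge 2$ and $d\ge 1$ be integers, let $0<\theta<1$ with $d\theta>1$, and let $p\in(1,\infty)$ be determined by $d\theta=d^{1/p}$. **Sequences.** Let $\omega^{\not\downarrow\le k}$ (resp. $\omega^{\not\downarrow k}$) be the set of non-decreasing sequences of natural numbers of length at most $k$ (resp. exactly $k$). Order it by $\prec$: the empty sequence is the minimum, and for nonempty $s,t$ one has $s\prec t$ iff the last term of $s$ is smaller than the last term of $t$, or the last terms agree and $s$ is lexicographically below $t$ (proper initial segments being lexicographically below). Write $s\sqsubset t$ if $s$ is a proper initial segment of $t$. **The space $\mathcal E_k$.** Let $\mathcal E_k$ be the collection of all ranges $X=\widehat X[\omega^{\not\downarrow k}]$, where $\widehat X$ is a map of $\omega^{\not\downarrow\le k}$ into itself that preserves $\prec$ and $\sqsubset$. Let $\mathcal{AR}^k_n$ be the collection of the sets consisting of the $\prec$-least $n$ members of some $X\in\mathcal E_k$, let $\mathcal{AR}^k=\bigcup_{n\ge1}\mathcal{AR}^k_n$, and let $\mathcal A^k_d=\bigcup_{i=1}^d\mathcal{AR}^k_i$. For $v=(n_1,\dots,n_k)\in\omega^{\not\downarrow k}$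 put $f_j(0)=n_j$ and $f_j(m)=n_k+m$ for $m\ge1$, and let $X_v^{\max}=\{(f_1(m_1),\dots,f_k(m_k)):(m_1,\dots,m_k)\in\omega^{\not\downarrow k}\}$. **The Banach space $T(\mathcal A^k_d,\theta)$.** For nonempty finite $E,F\subset\omega^{\not\downarrow k}$ and $v\in\omega^{\not\downarrow k}$, write $E<F$ if $\max_\prec E\prec\min_\prec F$, $v\le E$ if $v\preceq\min_\prec E$, and $E<v$ if $\max_\prec E\prec v$; these relations are applied to finitely supported vectors through their supports. A sequence $(E_i)_{i=1}^m$ in $\mathcal{AR}^k$, $1\le m\le d$, is *$\mathcal A^k_d$-admissible* if there is $\{v_1,\dots,v_m\}\in\mathcal A^k_d$ with $v_1\le E_1<v_2\le E_2<\cdots<v_m\le E_m$. On the space $c_{00}(\omega^{\not\downarrow k})$ of finitely supported $x:\omega^{\not\downarrow k}\to\mathbb R$ put $|x|_0=\max_v|x_v|$, $$|x|_{j+1}=\max\Big\{|x|_j,\ \theta\max\Big\{\sum_{i=1}^m|E_ix|_j:\ 1\le m\le d,\ (E_i)_{i=1}^m\ \mathcal A^k_d\text{-admissible}\Big\}\Big\},$$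 where $E x$ is the restriction of $x$ to $E$, and $\|x\|=\sup_j|x|_j$. Let $T(\mathcal A^k_d,\theta)$ be the completion of $c_{00}(\omega^{\not\downarrow k})$ in this norm. **Theorem.** Let $(x_i)_{i=1}^\infty$ be a normalized block sequence in $T(\mathcal A^k_d,\theta)$ (finitely supported vectors of norm one with $x_1<x_2<\cdots$), and suppose that there is a sequence $(v_i)_{i=1}^\infty$ in $\omega^{\not\downarrow k}$ such that 1. $v_1\le x_1<v_2\le x_2<v_3\le x_3<\cdots$, and 2. $\operatorname{supp}x_i\subset X_{v_i}^{\max}$ and $v_{i+1}\in X_{v_i}^{\max}$ for every $i\ge1$. Then $(x_i)$ is equivalent to the canonical basis of $\ell_p$: there are constants $c,C>0$ such that $$c\Big(\sum_i|a_i|^p\Big)^{1/p}\le\Big\|\sum_ia_ix_i\Big\|_{T(\mathcal A^k_d,\theta)}\le C\Big(\sum_i|a_i|^p\Big)^{1/p}$$ for all finitely supported real sequences $(a_i)$. -/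

import Mathlib

namespace HighDimEllentuck

/-! ### The well-ordered sets of non-decreasing sequences -/

/-- Non-decreasing sequences of natural numbers of length at most `k`. -/
def Omle (k : ℕ) : Type := {s : List ℕ // s.Pairwise (· ≤ ·) ∧ s.length ≤ k}

/-- Non-decreasing sequences of natural numbers of length exactly `k`. -/
def Ome (k : ℕ) : Type := {s : List ℕ // s.Pairwise (· ≤ ·) ∧ s.length = k}

/-- The inclusion of `Ome k` in `Omle k`. -/
def Ome.toOmle {k : ℕ} (v : Ome k) : Omle k := ⟨v.1, v.2.1, v.2.2.le⟩

/-- The well-order `≺` : the empty sequence comes first; nonempty sequences are compared by their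
last terms, and lexicographically when these agree (`s < t` on lists is the lexicographic order,
in which a proper initial segment of a sequence is below that sequence). -/
def Prec (s t : List ℕ) : Prop :=
  (s = [] ∧ t ≠ []) ∨
    (s ≠ [] ∧ t ≠ [] ∧
      (s.getLastD 0 < t.getLastD 0 ∨ (s.getLastD 0 = t.getLastD 0 ∧ s < t)))

/-- `s ⊏ t` : `s` is a proper initial segment of `t`. -/
def InitSeg (s t : List ℕ) : Prop := s <+: t ∧ s ≠ t

/-- The strict order `≺` on `Ome k`. -/
def Ome.lt {k : ℕ} (v w : Ome k) : Prop := Prec v.1 w.1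

/-- The non-strict order `⪯` on `Ome k`. -/
def Ome.le {k : ℕ} (v w : Ome k) : Prop := v = w ∨ v.lt w

/-! ### The spaces `𝓔_k` and their finite approximations -/

/-- An `𝓔_k`-tree: a map of `Omle k` into itself preserving `≺` and initial segments. -/
def IsEllentuckTree {k : ℕ} (T : Omle k → Omle k) : Prop :=
  (∀ s t, Prec s.1 t.1 → Prec (T s).1 (T t).1) ∧
    (∀ s t, InitSeg s.1 t.1 → InitSeg (T s).1 (T t).1)

/-- The space `𝓔_k`. A member is identified with the range of the restriction to `Ome k` of an
`𝓔_k`-tree (such a tree preserves lengths, hence maps `Ome k` into itself). -/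
def Ellentuck (k : ℕ) : Set (Set (Ome k)) :=
  {X | ∃ T : Omle k → Omle k, IsEllentuckTree T ∧ X = {v | ∃ u : Ome k, T u.toOmle = v.toOmle}}

/-- `𝓐𝓡_n^k` : the sets `r_n(X)` consisting of the `≺`-least `n` members of some `X ∈ 𝓔_k`. -/
def ApproxN (k n : ℕ) : Set (Finset (Ome k)) :=
  {E | E.card = n ∧ ∃ X ∈ Ellentuck k,
    (∀ v ∈ E, v ∈ X) ∧ ∀ v ∈ E, ∀ w ∈ X, w.lt v → w ∈ E}

/-- `𝓐𝓡^k` : the (nonempty) finite approximations to members of `𝓔_k`. -/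
def Approx (k : ℕ) : Set (Finset (Ome k)) :=
  {E | E.Nonempty ∧ ∃ n, E ∈ ApproxN k n}

/-- `𝓐_d^k = ⋃_{i=1}^d 𝓐𝓡_i^k`. -/
def LowComplexity (k d : ℕ) : Set (Finset (Ome k)) :=
  {E | ∃ i, 1 ≤ i ∧ i ≤ d ∧ E ∈ ApproxN k i}

/-- `E < F` for finite subsets of `Ome k`. -/
def SetLT {k : ℕ} (E F : Finset (Ome k)) : Prop := ∀ v ∈ E, ∀ w ∈ F, v.lt w

/-- `v ≤ E`. -/
def PointLE {k : ℕ} (v : Ome k) (E : Finset (Ome k)) : Prop := ∀ w ∈ E, v.le w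

/-- `E < v`. -/
def LTPoint {k : ℕ} (E : Finset (Ome k)) (v : Ome k) : Prop := ∀ w ∈ E, w.lt v

open Classical in
/-- `(E_i)_{i=1}^m` in `𝓐𝓡^k` is `𝓐_d^k`-admissible: there is `{v_1, …, v_m} ∈ 𝓐_d^k` such that
`v_1 ≤ E_1 < v_2 ≤ E_2 < ⋯ < v_m ≤ E_m`. -/
def Admissible (k d : ℕ) {m : ℕ} (E : Fin m → Finset (Ome k)) : Prop :=
  (∀ i, E i ∈ Approx k) ∧
    ∃ v : Fin m → Ome k, Finset.univ.image v ∈ LowComplexity k d ∧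
      (∀ i, PointLE (v i) (E i)) ∧ ∀ i j, i < j → LTPoint (E i) (v j)

/-! ### The special maximal members of `𝓔_k` -/

/-- For `v = (n_1, …, n_k)` and `t = (m_1, …, m_l)`, `l ≤ k`, the sequence
`(f_1(m_1), …, f_l(m_l))`, where `f_j(0) = n_j` and `f_j(m) = n_k + m` for `m > 0`. -/
def maxTree (v t : List ℕ) : List ℕ :=
  List.zipWith (fun n m => if m = 0 then n else v.getLastD 0 + m) v t

/-- `X_v^max`, as a subset of `Ome k`. -/
def Xmax {k : ℕ} (v : Ome k) : Set (Ome k) := {w | ∃ u : Ome k, maxTree v.1 u.1 = w.1}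

/-! ### The norm -/

open Classical in
/-- The restriction `E x = ∑_{v ∈ E} x_v e_v`. -/
noncomputable def restr {k : ℕ} (E : Finset (Ome k)) (x : Ome k →₀ ℝ) : Ome k →₀ ℝ :=
  x.filter (· ∈ E)

/-- The increasing sequence of norms `|x|_j` on `c_00`. -/
noncomputable def normStep (k d : ℕ) (θ : ℝ) : ℕ → (Ome k →₀ ℝ) → ℝ
  | 0, x => ⨆ v, |x v|
  | j + 1, x => max (normStep k d θ j x)
      (θ * sSup {r | ∃ m : ℕ, 1 ≤ m ∧ m ≤ d ∧ ∃ E : Fin m → Finset (Ome k),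
        Admissible k d E ∧ r = ∑ i, normStep k d θ j (restr (E i) x)})

/-- The norm of `T(𝓐_d^k, θ)` on `c_00`. -/
noncomputable def tNorm (k d : ℕ) (θ : ℝ) (x : Ome k →₀ ℝ) : ℝ := ⨆ j, normStep k d θ j x

/-! ### `tNorm` is a norm -/

theorem prec_irrefl (s : List ℕ) : ¬ Prec s s := by
  rintro (⟨h, h'⟩ | ⟨-, -, h | ⟨-, h⟩⟩)
  · exact h' h
  · exact lt_irrefl _ h
  · exact lt_irrefl _ h

theorem prec_asymm {s t : List ℕ} (h : Prec s t) : ¬ Prec t s := by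
  rintro (⟨h1, h2⟩ | ⟨h1, h2, h3⟩)
  · rcases h with ⟨h4, h5⟩ | ⟨h4, h5, h6⟩
    · exact h5 h1
    · exact h5 h1
  · rcases h with ⟨h4, h5⟩ | ⟨h4, h5, h6⟩
    · exact h2 h4
    · rcases h3 with h3 | ⟨h3, h3'⟩ <;> rcases h6 with h6 | ⟨h6, h6'⟩
      · exact lt_asymm h3 h6
      · omega
      · omega
      · exact lt_asymm h3' h6'

theorem Admissible.disjoint {k d m : ℕ} {E : Fin m → Finset (Ome k)} (h : Admissible k d E)
    {i j : Fin m} (hij : i ≠ j) : Disjoint (E i) (E j) := by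
  obtain ⟨-, v, -, h1, h2⟩ := h
  have key : ∀ i j : Fin m, i < j → Disjoint (E i) (E j) := by
    intro i j hij
    rw [Finset.disjoint_left]
    intro a ha hb
    have h3 : a.lt (v j) := h2 i j hij a ha
    rcases h1 j a hb with h4 | h4
    · rw [h4] at h3
      exact prec_irrefl _ h3
    · exact prec_asymm h3 h4
  rcases lt_or_gt_of_ne hij with h | h
  · exact key i j h
  · exact (key j i h).symm

/-- The `ℓ_1`-norm on `c_00`. -/
noncomputable def oneNorm {k : ℕ} (x : Ome k →₀ ℝ) : ℝ := ∑ v ∈ x.support, |x v|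

theorem oneNorm_nonneg {k : ℕ} (x : Ome k →₀ ℝ) : 0 ≤ oneNorm x :=
  Finset.sum_nonneg fun _ _ => abs_nonneg _

theorem abs_le_oneNorm {k : ℕ} (x : Ome k →₀ ℝ) (v : Ome k) : |x v| ≤ oneNorm x := by
  by_cases h : v ∈ x.support
  · exact Finset.single_le_sum (f := fun v => |x v|) (fun _ _ => abs_nonneg _) h
  · rw [Finsupp.notMem_support_iff.1 h, abs_zero]
    exact oneNorm_nonneg x

theorem sum_oneNorm_restr_le {k d m : ℕ} {E : Fin m → Finset (Ome k)} (h : Admissible k d E)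
    (x : Ome k →₀ ℝ) : ∑ i, oneNorm (restr (E i) x) ≤ oneNorm x := by
  classical
  have h1 : ∀ i, oneNorm (restr (E i) x) = ∑ v ∈ x.support.filter (· ∈ E i), |x v| := by
    intro i
    unfold oneNorm restr
    rw [Finsupp.support_filter]
    refine Finset.sum_congr (by ext; simp) fun v hv => ?_
    rw [Finsupp.filter_apply_pos _ _ (by simpa using (Finset.mem_filter.1 hv).2)]
  simp only [h1]
  rw [← Finset.sum_biUnion]
  · refine Finset.sum_le_sum_of_subset_of_nonneg ?_ fun _ _ _ => abs_nonneg _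
    intro v hv
    obtain ⟨i, -, hi⟩ := Finset.mem_biUnion.1 hv
    exact (Finset.mem_filter.1 hi).1
  · intro i _ j _ hij
    refine Finset.disjoint_left.2 fun v hv hw => ?_
    exact Finset.disjoint_left.1 (h.disjoint hij) (Finset.mem_filter.1 hv).2
      (Finset.mem_filter.1 hw).2

open Classical in
theorem restr_add {k : ℕ} (E : Finset (Ome k)) (x y : Ome k →₀ ℝ) :
    restr E (x + y) = restr E x + restr E y := Finsupp.filter_add

open Classical in
theorem restr_smul {k : ℕ} (E : Finset (Ome k)) (c : ℝ) (x : Ome k →₀ ℝ) :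
    restr E (c • x) = c • restr E x := Finsupp.filter_smul

section

variable {k d : ℕ} {θ : ℝ}

theorem bddAbove_coord (x : Ome k →₀ ℝ) : BddAbove (Set.range fun v => |x v|) :=
  ⟨oneNorm x, by rintro _ ⟨v, rfl⟩; exact abs_le_oneNorm x v⟩

theorem normStep_le_oneNorm (h0 : 0 ≤ θ) (h1 : θ ≤ 1) (j : ℕ) (x : Ome k →₀ ℝ) :
    normStep k d θ j x ≤ oneNorm x := by
  induction j generalizing x with
  | zero => exact Real.iSup_le (abs_le_oneNorm x) (oneNorm_nonneg x)
  | succ j ih =>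
    refine max_le (ih x) ?_
    refine (mul_le_mul_of_nonneg_left (Real.sSup_le ?_ (oneNorm_nonneg x)) h0).trans
      (mul_le_of_le_one_left (oneNorm_nonneg x) h1)
    rintro _ ⟨m, -, -, E, hE, rfl⟩
    exact (Finset.sum_le_sum fun i _ => ih _).trans (sum_oneNorm_restr_le hE x)

theorem normStep_mono (j : ℕ) (x : Ome k →₀ ℝ) :
    normStep k d θ 0 x ≤ normStep k d θ j x := by
  induction j with
  | zero => exact le_rfl
  | succ j ih => exact ih.trans (le_max_left _ _)

theorem normStep_nonneg (j : ℕ) (x : Ome k →₀ ℝ) : 0 ≤ normStep k d θ j x :=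
  (Real.iSup_nonneg fun _ => abs_nonneg _).trans (normStep_mono j x)

theorem abs_le_normStep (j : ℕ) (x : Ome k →₀ ℝ) (v : Ome k) : |x v| ≤ normStep k d θ j x :=
  (le_ciSup (bddAbove_coord x) v).trans (normStep_mono j x)

theorem bddAbove_step (h0 : 0 ≤ θ) (h1 : θ ≤ 1) (j : ℕ) (x : Ome k →₀ ℝ) :
    BddAbove {r | ∃ m : ℕ, 1 ≤ m ∧ m ≤ d ∧ ∃ E : Fin m → Finset (Ome k),
        Admissible k d E ∧ r = ∑ i, normStep k d θ j (restr (E i) x)} := by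
  refine ⟨oneNorm x, ?_⟩
  rintro _ ⟨m, -, -, E, hE, rfl⟩
  exact (Finset.sum_le_sum fun i _ => normStep_le_oneNorm h0 h1 j _).trans
    (sum_oneNorm_restr_le hE x)

theorem le_step (h0 : 0 ≤ θ) (h1 : θ ≤ 1) (j : ℕ) (x : Ome k →₀ ℝ) {m : ℕ} (hm : 1 ≤ m)
    (hmd : m ≤ d) {E : Fin m → Finset (Ome k)} (hE : Admissible k d E) :
    ∑ i, normStep k d θ j (restr (E i) x) ≤
      sSup {r | ∃ m : ℕ, 1 ≤ m ∧ m ≤ d ∧ ∃ E : Fin m → Finset (Ome k),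
        Admissible k d E ∧ r = ∑ i, normStep k d θ j (restr (E i) x)} :=
  le_csSup (bddAbove_step h0 h1 j x) ⟨m, hm, hmd, E, hE, rfl⟩

theorem step_nonneg (j : ℕ) (x : Ome k →₀ ℝ) :
    0 ≤ sSup {r | ∃ m : ℕ, 1 ≤ m ∧ m ≤ d ∧ ∃ E : Fin m → Finset (Ome k),
        Admissible k d E ∧ r = ∑ i, normStep k d θ j (restr (E i) x)} := by
  refine Real.sSup_nonneg ?_
  rintro _ ⟨m, -, -, E, -, rfl⟩
  exact Finset.sum_nonneg fun i _ => normStep_nonneg j _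

theorem normStep_add_le (h0 : 0 ≤ θ) (h1 : θ ≤ 1) (j : ℕ) (x y : Ome k →₀ ℝ) :
    normStep k d θ j (x + y) ≤ normStep k d θ j x + normStep k d θ j y := by
  induction j generalizing x y with
  | zero =>
    refine Real.iSup_le (fun v => ?_) (add_nonneg (normStep_nonneg 0 x) (normStep_nonneg 0 y))
    rw [Finsupp.add_apply]
    exact (abs_add_le _ _).trans (add_le_add (abs_le_normStep 0 x v) (abs_le_normStep 0 y v))
  | succ j ih =>
    refine max_le ((ih x y).trans (add_le_add (le_max_left _ _) (le_max_left _ _))) ?_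
    refine le_trans ?_ (add_le_add (le_max_right _ _) (le_max_right _ _))
    rw [← mul_add]
    refine mul_le_mul_of_nonneg_left ?_ h0
    refine Real.sSup_le ?_ (add_nonneg (step_nonneg j x) (step_nonneg j y))
    rintro _ ⟨m, hm, hmd, E, hE, rfl⟩
    refine le_trans ?_ (add_le_add (le_step h0 h1 j x hm hmd hE) (le_step h0 h1 j y hm hmd hE))
    rw [← Finset.sum_add_distrib]
    refine Finset.sum_le_sum fun i _ => ?_
    rw [restr_add]
    exact ih _ _

theorem normStep_smul_le (h0 : 0 ≤ θ) (h1 : θ ≤ 1) (j : ℕ) (c : ℝ) (x : Ome k →₀ ℝ) :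
    normStep k d θ j (c • x) ≤ |c| * normStep k d θ j x := by
  induction j generalizing x with
  | zero =>
    refine Real.iSup_le (fun v => ?_) (mul_nonneg (abs_nonneg c) (normStep_nonneg 0 x))
    rw [Finsupp.smul_apply, smul_eq_mul, abs_mul]
    exact mul_le_mul_of_nonneg_left (abs_le_normStep 0 x v) (abs_nonneg c)
  | succ j ih =>
    refine max_le ((ih x).trans
      (mul_le_mul_of_nonneg_left (le_max_left _ _) (abs_nonneg c))) ?_
    refine le_trans ?_ (mul_le_mul_of_nonneg_left (le_max_right _ _) (abs_nonneg c))
    rw [mul_left_comm]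
    refine mul_le_mul_of_nonneg_left ?_ h0
    refine Real.sSup_le ?_ (mul_nonneg (abs_nonneg c) (step_nonneg j x))
    rintro _ ⟨m, hm, hmd, E, hE, rfl⟩
    refine le_trans ?_ (mul_le_mul_of_nonneg_left (le_step h0 h1 j x hm hmd hE) (abs_nonneg c))
    rw [Finset.mul_sum]
    refine Finset.sum_le_sum fun i _ => ?_
    rw [restr_smul]
    exact ih _

theorem bddAbove_normStep (h0 : 0 ≤ θ) (h1 : θ ≤ 1) (x : Ome k →₀ ℝ) :
    BddAbove (Set.range fun j => normStep k d θ j x) :=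
  ⟨oneNorm x, by rintro _ ⟨j, rfl⟩; exact normStep_le_oneNorm h0 h1 j x⟩

theorem normStep_le_tNorm (h0 : 0 ≤ θ) (h1 : θ ≤ 1) (j : ℕ) (x : Ome k →₀ ℝ) :
    normStep k d θ j x ≤ tNorm k d θ x := le_ciSup (bddAbove_normStep h0 h1 x) j

theorem tNorm_nonneg (x : Ome k →₀ ℝ) : 0 ≤ tNorm k d θ x :=
  Real.iSup_nonneg fun j => normStep_nonneg j x

theorem tNorm_add_le (h0 : 0 ≤ θ) (h1 : θ ≤ 1) (x y : Ome k →₀ ℝ) :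
    tNorm k d θ (x + y) ≤ tNorm k d θ x + tNorm k d θ y :=
  ciSup_le fun j => (normStep_add_le h0 h1 j x y).trans
    (add_le_add (normStep_le_tNorm h0 h1 j x) (normStep_le_tNorm h0 h1 j y))

theorem tNorm_smul_le (h0 : 0 ≤ θ) (h1 : θ ≤ 1) (c : ℝ) (x : Ome k →₀ ℝ) :
    tNorm k d θ (c • x) ≤ |c| * tNorm k d θ x :=
  ciSup_le fun j => (normStep_smul_le h0 h1 j c x).trans
    (mul_le_mul_of_nonneg_left (normStep_le_tNorm h0 h1 j x) (abs_nonneg c))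

theorem tNorm_zero (h0 : 0 ≤ θ) (h1 : θ ≤ 1) : tNorm k d θ 0 = 0 := by
  refine le_antisymm ?_ (tNorm_nonneg 0)
  simpa using tNorm_smul_le (k := k) (d := d) h0 h1 0 0

theorem tNorm_neg (h0 : 0 ≤ θ) (h1 : θ ≤ 1) (x : Ome k →₀ ℝ) :
    tNorm k d θ (-x) = tNorm k d θ x := by
  have key : ∀ y : Ome k →₀ ℝ, tNorm k d θ (-y) ≤ tNorm k d θ y := fun y => by
    simpa using tNorm_smul_le (k := k) (d := d) h0 h1 (-1) y
  refine le_antisymm (key x) ?_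
  simpa using key (-x)

theorem eq_zero_of_tNorm (h0 : 0 ≤ θ) (h1 : θ ≤ 1) (x : Ome k →₀ ℝ)
    (hx : tNorm k d θ x = 0) : x = 0 := by
  ext v
  have h2 : |x v| ≤ 0 := hx ▸ (abs_le_normStep 0 x v).trans (normStep_le_tNorm h0 h1 0 x)
  simpa using h2

end

/-! ### The Banach space `T(𝓐_d^k, θ)` -/

/-- The space `c_00` over `Ome k`, to be equipped with the norm of `T(𝓐_d^k, θ)`. -/
def C00 (k _d : ℕ) (_θ : Set.Ioo (0 : ℝ) 1) : Type := Ome k →₀ ℝ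

noncomputable instance (k d : ℕ) (θ : Set.Ioo (0 : ℝ) 1) : AddCommGroup (C00 k d θ) :=
  inferInstanceAs (AddCommGroup (Ome k →₀ ℝ))

noncomputable instance (k d : ℕ) (θ : Set.Ioo (0 : ℝ) 1) : Module ℝ (C00 k d θ) :=
  inferInstanceAs (Module ℝ (Ome k →₀ ℝ))

noncomputable instance (k d : ℕ) (θ : Set.Ioo (0 : ℝ) 1) : NormedAddCommGroup (C00 k d θ) :=
  AddGroupNorm.toNormedAddCommGroup
    { toFun := fun x => tNorm k d θ x
      map_zero' := tNorm_zero θ.2.1.le θ.2.2.le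
      add_le' := fun x y => tNorm_add_le θ.2.1.le θ.2.2.le x y
      neg' := fun x => tNorm_neg θ.2.1.le θ.2.2.le x
      eq_zero_of_map_eq_zero' := fun x hx => eq_zero_of_tNorm θ.2.1.le θ.2.2.le x hx }

noncomputable instance (k d : ℕ) (θ : Set.Ioo (0 : ℝ) 1) : NormedSpace ℝ (C00 k d θ) where
  norm_smul_le c x := tNorm_smul_le θ.2.1.le θ.2.2.le c x

/-- The support of a member of `c_00`. -/
def C00.supp {k d : ℕ} {θ : Set.Ioo (0 : ℝ) 1} (x : C00 k d θ) : Finset (Ome k) :=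
  Finsupp.support x

/-- The Banach space `T(𝓐_d^k, θ)`: the completion of `c_00`. -/
abbrev TSpace (k d : ℕ) (θ : Set.Ioo (0 : ℝ) 1) : Type := UniformSpace.Completion (C00 k d θ)

/-- `(x_i)` is a normalized block sequence of the canonical basis of `T(𝓐_d^k, θ)`: finitely
supported vectors of norm one with `x_1 < x_2 < ⋯`. (The norm on `C00 k d θ` is that of
`T(𝓐_d^k, θ)`, in which `C00 k d θ` embeds isometrically.) -/
def IsNormalizedBlockSeq {k d : ℕ} {θ : Set.Ioo (0 : ℝ) 1} (x : ℕ → C00 k d θ) : Prop :=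
  (∀ i, ‖x i‖ = 1) ∧ ∀ i, SetLT (x i).supp (x (i + 1)).supp

/-- Equivalence of two sequences `(x_i)`, `(y_i)` in normed spaces: for some constants `c, C > 0`,
`c ‖∑ a_i y_i‖ ≤ ‖∑ a_i x_i‖ ≤ C ‖∑ a_i y_i‖` for all finitely supported scalar sequences. -/
def EquivalentSeq {X Y : Type*} [NormedAddCommGroup X] [NormedSpace ℝ X]
    [NormedAddCommGroup Y] [NormedSpace ℝ Y] (x : ℕ → X) (y : ℕ → Y) : Prop :=
  ∃ c > (0 : ℝ), ∃ C > (0 : ℝ), ∀ a : ℕ →₀ ℝ,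
    c * ‖a.sum fun i r => r • y i‖ ≤ ‖a.sum fun i r => r • x i‖ ∧
      ‖a.sum fun i r => r • x i‖ ≤ C * ‖a.sum fun i r => r • y i‖

/-- The canonical unit vector basis of `ℓ_p`. -/
noncomputable def lpBasis (p : ENNReal) (i : ℕ) : lp (fun _ : ℕ => ℝ) p :=
  lp.single p i (1 : ℝ)

end HighDimEllentuck

open HighDimEllentuck

namespace HighDimEllentuck

/-! ### The order `≺` -/

/-! The upper estimate holds for every normalized block sequence; of admissibility it uses only that
an admissible family consists of at most `d` successive sets. When the norm is unfolded, a set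
meeting the blocks in an interval of indices is cut into at most `d` successive children. Hölder's
inequality over the children costs `d ^ (1 - 1/p)`, which is exactly `1/θ`, so an `ℓ_p` bound would
reproduce itself if no block were shared between children. Shared blocks are absorbed by
`blockWeight`: a set meeting a single block has weight `1` there, while end blocks and interior
blocks of a longer interval have larger constant weights. Only the children confined to an end block
of the parent do not fit. They leave at most `d - 1` children to Hölder, and the gap `d ^ q - (d -
1) ^ q`, `q = 1 - 1/p`, pays for them (`mul_sum_le_of_blockWeight`, `normStep_restr_le`).

For the lower estimate, suppose that splitting a combination into at most `d` consecutive pieces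
costs only the factor `θ`. Iterating along a `d`-adic tree bounds the sum of the `θ ^ n_i |a_i|` by
the norm, where `n_i` is the depth at which `i` becomes isolated. Points carrying the masses `w_i =
|a_i|^p / ∑ |a_j|^p`, placed in order in `[0, 1)`, are isolated by cells of length comparable to
`w_i`. At these depths `θ ^ n_i |a_i|` is at least `w_i (∑ |a_j|^p)^(1/p) / (2d)`, and the `w_i` sum
to `1` (`sum_rpow_le_of_splitting`).

Such splittings exist because the sets `X_{v_i}^max` decrease: the supports of the blocks from `p`
to `q` lie in the part of `X_{v_p}^max` below `v_{q+1}`, which is an approximation. The separating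
points must themselves form a member of `𝓐_d^k`; `exists_approx_near` finds them with last terms
prescribed up to a bounded error `M`. This suffices for indices that are at least `M` and have gaps
larger than `M` (`splitting_of_separated`). Residue classes modulo `M + 1` reduce the general case
to this one. -/

theorem prec_trans {s t u : List ℕ} (h1 : Prec s t) (h2 : Prec t u) : Prec s u := by
  rcases h1 with ⟨hs, ht⟩ | ⟨hs, ht, h⟩
  · rcases h2 with ⟨ht', hu⟩ | ⟨-, hu, -⟩
    exacts [absurd ht' ht, Or.inl ⟨hs, hu⟩]
  · rcases h2 with ⟨ht', hu⟩ | ⟨-, hu, h'⟩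
    · exact absurd ht' ht
    · refine Or.inr ⟨hs, hu, ?_⟩
      rcases h with h | ⟨h, hl⟩ <;> rcases h' with h' | ⟨h', hl'⟩
      · exact Or.inl (h.trans h')
      · exact Or.inl (h' ▸ h)
      · exact Or.inl (h ▸ h')
      · exact Or.inr ⟨h.trans h', lt_trans hl hl'⟩

theorem prec_trichotomy (s t : List ℕ) : Prec s t ∨ s = t ∨ Prec t s := by
  by_cases hs : s = [] <;> by_cases ht : t = []
  · exact Or.inr (Or.inl (hs.trans ht.symm))
  · exact Or.inl (Or.inl ⟨hs, ht⟩)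
  · exact Or.inr (Or.inr (Or.inl ⟨ht, hs⟩))
  · rcases lt_trichotomy (s.getLastD 0) (t.getLastD 0) with h | h | h
    · exact Or.inl (Or.inr ⟨hs, ht, Or.inl h⟩)
    · rcases lt_trichotomy s t with h' | h' | h'
      · exact Or.inl (Or.inr ⟨hs, ht, Or.inr ⟨h, h'⟩⟩)
      · exact Or.inr (Or.inl h')
      · exact Or.inr (Or.inr (Or.inr ⟨ht, hs, Or.inr ⟨h.symm, h'⟩⟩))
    · exact Or.inr (Or.inr (Or.inr ⟨ht, hs, Or.inl h⟩))

theorem Prec.last_le {s t : List ℕ} (h : Prec s t) : s.getLastD 0 ≤ t.getLastD 0 := by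
  rcases h with ⟨rfl, -⟩ | ⟨-, -, h | ⟨h, -⟩⟩
  · simp
  · exact h.le
  · exact h.le

theorem prec_of_last_lt {s t : List ℕ} (h : s.getLastD 0 < t.getLastD 0) : Prec s t := by
  have ht : t ≠ [] := by rintro rfl; simp at h
  by_cases hs : s = []
  · exact Or.inl ⟨hs, ht⟩
  · exact Or.inr ⟨hs, ht, Or.inl h⟩

/-- The last term of a member of `Ome k`. -/
def Ome.last {k : ℕ} (v : Ome k) : ℕ := v.1.getLastD 0

theorem Ome.lt_trans {k : ℕ} {u v w : Ome k} (h1 : u.lt v) (h2 : v.lt w) : u.lt w :=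
  prec_trans h1 h2

theorem Ome.lt_irrefl {k : ℕ} (v : Ome k) : ¬ v.lt v := prec_irrefl _

theorem Ome.lt_of_le_of_lt {k : ℕ} {u v w : Ome k} (h1 : u.le v) (h2 : v.lt w) : u.lt w := by
  rcases h1 with rfl | h1
  exacts [h2, Ome.lt_trans h1 h2]

theorem Ome.lt_of_lt_of_le {k : ℕ} {u v w : Ome k} (h1 : u.lt v) (h2 : v.le w) : u.lt w := by
  rcases h2 with rfl | h2
  exacts [h1, Ome.lt_trans h1 h2]

theorem Ome.le.last_le {k : ℕ} {v w : Ome k} (h : v.le w) : v.last ≤ w.last := by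
  rcases h with rfl | h
  exacts [le_rfl, Prec.last_le h]

/-- In a non-decreasing sequence the last term bounds all the others. Hence `≺`-initial segments are
finite, which makes ranks natural numbers and segments of `X_v^max` finsets. -/
theorem finite_lists_of_last_le (k L : ℕ) :
    {s : List ℕ | (s.Pairwise (· ≤ ·) ∧ s.length ≤ k) ∧ s.getLastD 0 ≤ L}.Finite := by
  refine Set.Finite.subset ((List.finite_length_le (Fin (L + 1)) k).image (List.map Fin.val)) ?_
  rintro s ⟨⟨h1, h2⟩, h3⟩
  have hle : ∀ a ∈ s, a < L + 1 := by
    intro a ha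
    have hs : s ≠ [] := List.ne_nil_of_mem ha
    have : a ≤ s.getLast hs := h1.rel_getLast ha
    rw [List.getLastD_eq_getLast?, List.getLast?_eq_getLast_of_ne_nil hs] at h3
    simp at h3
    omega
  refine ⟨s.pmap (fun a h => ⟨a, h⟩) hle, by simpa using h2, ?_⟩
  rw [List.map_pmap]
  simp

theorem finite_setOf_prec (k : ℕ) (s : List ℕ) :
    {t : List ℕ | (t.Pairwise (· ≤ ·) ∧ t.length ≤ k) ∧ Prec t s}.Finite :=
  (finite_lists_of_last_le k (s.getLastD 0)).subset fun _ h => ⟨h.1, h.2.last_le⟩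

theorem Ome.finite_setOf_lt {k : ℕ} (v : Ome k) : {w : Ome k | w.lt v}.Finite := by
  refine Set.Finite.of_finite_image (f := Subtype.val) ((finite_setOf_prec k v.1).subset ?_)
    Subtype.val_injective.injOn
  rintro _ ⟨w, hw, rfl⟩
  exact ⟨⟨w.2.1, w.2.2.le⟩, hw⟩

/-! ### The norm is a lattice norm satisfying the implicit inequality -/

section

variable {k d : ℕ} {θ : ℝ}

theorem abs_restr_le (E : Finset (Ome k)) {x y : Ome k →₀ ℝ} (h : ∀ v, |x v| ≤ |y v|) (v : Ome k) :
    |restr E x v| ≤ |restr E y v| := by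
  classical
  by_cases hv : v ∈ E
  · simpa [restr, Finsupp.filter_apply, hv] using h v
  · simp [restr, hv]

theorem normStep_le_of_abs_le (h0 : 0 ≤ θ) (h1 : θ ≤ 1) (j : ℕ) {x y : Ome k →₀ ℝ}
    (h : ∀ v, |x v| ≤ |y v|) : normStep k d θ j x ≤ normStep k d θ j y := by
  induction j generalizing x y with
  | zero => exact Real.iSup_le (fun v => (h v).trans (abs_le_normStep 0 y v)) (normStep_nonneg 0 y)
  | succ j ih =>
    refine max_le ((ih h).trans (le_max_left _ _)) (le_trans ?_ (le_max_right _ _))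
    refine mul_le_mul_of_nonneg_left (Real.sSup_le ?_ (step_nonneg j y)) h0
    rintro _ ⟨m, hm, hmd, E, hE, rfl⟩
    exact (Finset.sum_le_sum fun i _ => ih (abs_restr_le (E i) h)).trans
      (le_step h0 h1 j y hm hmd hE)

theorem tNorm_le_of_abs_le (h0 : 0 ≤ θ) (h1 : θ ≤ 1) {x y : Ome k →₀ ℝ}
    (h : ∀ v, |x v| ≤ |y v|) : tNorm k d θ x ≤ tNorm k d θ y :=
  ciSup_le fun j => (normStep_le_of_abs_le h0 h1 j h).trans (normStep_le_tNorm h0 h1 j y)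

theorem abs_le_tNorm (h0 : 0 ≤ θ) (h1 : θ ≤ 1) (x : Ome k →₀ ℝ) (v : Ome k) :
    |x v| ≤ tNorm k d θ x :=
  (abs_le_normStep 0 x v).trans (normStep_le_tNorm h0 h1 0 x)

/-- One half of the implicit equation of the norm: the inequality holds at every stage `j`, and the
stages of each of the finitely many summands increase to their supremum. -/
theorem sum_tNorm_restr_le (h0 : 0 ≤ θ) (h1 : θ ≤ 1) (x : Ome k →₀ ℝ) {m : ℕ} (hm : 1 ≤ m)
    (hmd : m ≤ d) {E : Fin m → Finset (Ome k)} (hE : Admissible k d E) :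
    θ * ∑ i, tNorm k d θ (restr (E i) x) ≤ tNorm k d θ x := by
  have hlim : Filter.Tendsto (fun j => θ * ∑ i, normStep k d θ j (restr (E i) x)) Filter.atTop
      (nhds (θ * ∑ i, tNorm k d θ (restr (E i) x))) := by
    refine Filter.Tendsto.const_mul _ (tendsto_finsetSum _ fun i _ => ?_)
    exact tendsto_atTop_ciSup (monotone_nat_of_le_succ fun j => le_max_left _ _)
      (bddAbove_normStep h0 h1 _)
  refine le_of_tendsto' hlim fun j => ?_
  refine le_trans ?_ (normStep_le_tNorm h0 h1 (j + 1) x)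
  exact (mul_le_mul_of_nonneg_left (le_step h0 h1 j x hm hmd hE) h0).trans (le_max_right _ _)

end

/-! ### The upper estimate -/

/-- The weight given to the `i`-th block by a set meeting only blocks with index in `[m, n]`: the
first and the last block may be met only partially. -/
noncomputable def blockWeight (B C : ℝ) (m n i : ℕ) : ℝ :=
  (if m = i ∧ n = i then 1 else 0) + B * (if m = i ∧ i < n then 1 else 0) +
    B * (if m < i ∧ n = i then 1 else 0) + C * (if m < i ∧ i < n then 1 else 0)

theorem blockWeight_nonneg {B C : ℝ} (hB : 0 ≤ B) (hC : 0 ≤ C) (m n i : ℕ) :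
    0 ≤ blockWeight B C m n i := by
  unfold blockWeight
  have h : ∀ p : Prop, [Decidable p] → (0 : ℝ) ≤ if p then 1 else 0 := fun p _ => by
    split_ifs <;> norm_num
  have h1 := h (m = i ∧ n = i)
  have h2 := mul_nonneg hB (h (m = i ∧ i < n))
  have h3 := mul_nonneg hB (h (m < i ∧ n = i))
  have h4 := mul_nonneg hC (h (m < i ∧ i < n))
  linarith

theorem sum_blockWeight {ι : Type*} (A : Finset ι) (B C : ℝ) (m n : ι → ℕ) (i : ℕ) :
    ∑ c ∈ A, blockWeight B C (m c) (n c) i =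
      (A.filter fun c => m c = i ∧ n c = i).card + B * (A.filter fun c => m c = i ∧ i < n c).card +
        B * (A.filter fun c => m c < i ∧ n c = i).card +
          C * (A.filter fun c => m c < i ∧ i < n c).card := by
  simp only [blockWeight, Finset.sum_add_distrib, ← Finset.mul_sum, Finset.sum_boole]

/-- Count the children at a fixed block `i`. As they are ordered, at most one starts at `i` and goes
on, at most one ends there after starting earlier, and at most one passes over it. `hend` excludes
the children confined to an end block, for which the weight `B` could leave no room. -/
theorem sum_blockWeight_le {ι : Type*} [LinearOrder ι] {A : Finset ι} {B C : ℝ} {d : ℕ}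
    (hB : 0 ≤ B) (hC : d + 2 * B ≤ C) (hA : A.card ≤ d) {m' n' : ι → ℕ} {m n : ℕ} (hmn : m < n)
    (hle : ∀ c ∈ A, m' c ≤ n' c) (hord : ∀ c ∈ A, ∀ c' ∈ A, c < c' → n' c ≤ m' c')
    (hm : ∀ c ∈ A, m ≤ m' c) (hn : ∀ c ∈ A, n' c ≤ n)
    (hend : ∀ c ∈ A, ¬ (m' c = n' c ∧ (m' c = m ∨ m' c = n))) (i : ℕ) :
    ∑ c ∈ A, blockWeight B C (m' c) (n' c) i ≤ blockWeight B C m n i := by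
  classical
  have hC0 : 0 ≤ C := by have : (0 : ℝ) ≤ d := d.cast_nonneg; linarith
  rw [sum_blockWeight]
  have hcard : ∀ P : ι → Prop, [DecidablePred P] →
      (∀ c ∈ A, ∀ c' ∈ A, c < c' → P c → P c' → False) → ((A.filter P).card : ℝ) ≤ 1 := by
    intro P _ h
    have : (A.filter P).card ≤ 1 := by
      rw [Finset.card_le_one]
      intro c hc c' hc'
      rw [Finset.mem_filter] at hc hc'
      rcases lt_trichotomy c c' with h1 | h1 | h1
      · exact (h c hc.1 c' hc'.1 h1 hc.2 hc'.2).elim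
      · exact h1
      · exact (h c' hc'.1 c hc.1 h1 hc'.2 hc.2).elim
    exact_mod_cast this
  have hempty : ∀ P : ι → Prop, [DecidablePred P] → (∀ c ∈ A, ¬ P c) →
      ((A.filter P).card : ℝ) = 0 := by
    intro P _ h
    rw [Finset.filter_eq_empty_iff.2 (fun c hc => h c hc)]
    simp
  have hle1 : ((A.filter fun c => m' c = i ∧ n' c = i).card : ℝ) ≤ d := by
    exact_mod_cast (Finset.card_filter_le _ _).trans hA
  have hle2 : ((A.filter fun c => m' c = i ∧ i < n' c).card : ℝ) ≤ 1 :=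
    hcard _ fun c hc c' hc' hcc h1 h2 => by have := hord c hc c' hc' hcc; omega
  have hle3 : ((A.filter fun c => m' c < i ∧ n' c = i).card : ℝ) ≤ 1 :=
    hcard _ fun c hc c' hc' hcc h1 h2 => by have := hord c hc c' hc' hcc; omega
  have hle4 : ((A.filter fun c => m' c < i ∧ i < n' c).card : ℝ) ≤ 1 :=
    hcard _ fun c hc c' hc' hcc h1 h2 => by have := hord c hc c' hc' hcc; omega
  have hmul2 := mul_le_mul_of_nonneg_left hle2 hB
  have hmul3 := mul_le_mul_of_nonneg_left hle3 hB
  have hmul4 := mul_le_mul_of_nonneg_left hle4 hC0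
  by_cases hint : m < i ∧ i < n
  · have hR : blockWeight B C m n i = C := by
      simp [blockWeight, hint, hint.1.ne, hint.2.ne']
    rw [hR]
    -- A child passing over block `i` excludes all others there and costs `C`. Otherwise at most `d`
    -- confined children and two partial ones cost `d + 2 * B`.
    by_cases h4 : ∃ c ∈ A, m' c < i ∧ i < n' c
    · obtain ⟨c, hc, hc1, hc2⟩ := h4
      have hne : ∀ c' ∈ A, m' c' = i ∨ n' c' = i → False := by
        intro c' hc' h
        have := hle c' hc'
        rcases lt_trichotomy c c' with h1 | rfl | h1
        · have := hord c hc c' hc' h1; omega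
        · omega
        · have := hord c' hc' c hc h1; omega
      rw [hempty _ fun c' hc' h => hne c' hc' (Or.inl h.1),
        hempty _ fun c' hc' h => hne c' hc' (Or.inl h.1),
        hempty _ fun c' hc' h => hne c' hc' (Or.inr h.2)]
      linarith
    · push Not at h4
      rw [hempty (fun c => m' c < i ∧ i < n' c) fun c hc h => by
        have := h4 c hc h.1; omega]
      linarith
  · rw [hempty (fun c => m' c < i ∧ i < n' c) fun c hc h => by
      have := hm c hc; have := hn c hc; omega]
    by_cases him : m = i
    · have hR : blockWeight B C m n i = B := by
        have : n ≠ i := by omega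
        have : i < n := by omega
        simp [blockWeight, *]
      rw [hR, hempty (fun c => m' c = i ∧ n' c = i) fun c hc h => by
          have := hend c hc; omega,
        hempty (fun c => m' c < i ∧ n' c = i) fun c hc h => by have := hm c hc; omega]
      linarith
    · by_cases hin : n = i
      · have hR : blockWeight B C m n i = B := by
          have : m < i := by omega
          simp [blockWeight, *]
        rw [hR, hempty (fun c => m' c = i ∧ n' c = i) fun c hc h => by
            have := hend c hc; omega,
          hempty (fun c => m' c = i ∧ i < n' c) fun c hc h => by have := hn c hc; omega]
        linarith
      · have hR : blockWeight B C m n i = 0 := by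
          simp [blockWeight, him, hin, hint]
        have hout : i < m ∨ n < i := by omega
        rw [hR, hempty (fun c => m' c = i ∧ n' c = i) fun c hc h => by
            have := hm c hc; have := hn c hc; omega,
          hempty (fun c => m' c = i ∧ i < n' c) fun c hc h => by
            have := hm c hc; have := hn c hc; omega,
          hempty (fun c => m' c < i ∧ n' c = i) fun c hc h => by
            have := hm c hc; have := hn c hc; omega]
        linarith

/-- Hölder's inequality against the constant function `1`. -/
theorem sum_le_card_rpow_mul {ι : Type*} (s : Finset ι) {r : ℝ} (hr : 1 < r) {f G : ι → ℝ}
    (hG : ∀ c ∈ s, 0 ≤ G c) (hf : ∀ c ∈ s, f c ≤ G c ^ (1 / r)) :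
    ∑ c ∈ s, f c ≤ (s.card : ℝ) ^ (1 - 1 / r) * (∑ c ∈ s, G c) ^ (1 / r) := by
  have hpq : (r / (r - 1)).HolderConjugate r := (Real.HolderConjugate.conjExponent hr).symm
  have h := Real.inner_le_Lp_mul_Lq_of_nonneg s (f := fun _ => (1 : ℝ))
    (g := fun c => G c ^ (1 / r)) hpq (fun _ _ => zero_le_one)
    (fun c hc => Real.rpow_nonneg (hG c hc) _)
  refine (Finset.sum_le_sum hf).trans ?_
  simp only [one_mul, Real.one_rpow, Finset.sum_const, nsmul_eq_mul, mul_one] at h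
  refine h.trans (le_of_eq ?_)
  congr 1
  · congr 1
    field_simp
  · congr 1
    refine Finset.sum_congr rfl fun c hc => ?_
    rw [← Real.rpow_mul (hG c hc), one_div_mul_cancel (by linarith), Real.rpow_one]

/-- The gap by which `card ^ (1 / q)` grows pays for the children contained in an end block. -/
theorem exists_end_constant {d : ℕ} (hd : 2 ≤ d) {q : ℝ} (hq : 0 < q) (hq1 : q ≤ 1) :
    ∃ β : ℝ, 1 ≤ β ∧ ∀ a b : ℕ, a + b ≤ d → (a : ℝ) ^ q + b / β ≤ (d : ℝ) ^ q := by
  have hd1 : (1 : ℝ) ≤ d := by exact_mod_cast (by omega : 1 ≤ d)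
  have hgap : 0 < (d : ℝ) ^ q - ((d : ℝ) - 1) ^ q :=
    sub_pos.2 (Real.rpow_lt_rpow (by linarith) (by linarith) hq)
  have hgap' : (d : ℝ) ^ q - ((d : ℝ) - 1) ^ q ≤ d := by
    have h1 : (d : ℝ) ^ q ≤ d := by
      simpa using Real.rpow_le_rpow_of_exponent_le hd1 hq1
    have h2 : 0 ≤ ((d : ℝ) - 1) ^ q := Real.rpow_nonneg (by linarith) _
    linarith
  -- With `β` equal to `d` over the gap, `b ≤ d` makes `b / β` at most the gap; and `b ≥ 1` forces
  -- `a ≤ d - 1`.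
  refine ⟨d / ((d : ℝ) ^ q - ((d : ℝ) - 1) ^ q), (one_le_div hgap).2 hgap', fun a b hab => ?_⟩
  rcases Nat.eq_zero_or_pos b with rfl | hb
  · simp only [Nat.cast_zero, zero_div, add_zero]
    exact Real.rpow_le_rpow (by positivity) (by exact_mod_cast (by omega : a ≤ d)) hq.le
  · have h1 : (a : ℝ) ^ q ≤ ((d : ℝ) - 1) ^ q := by
      refine Real.rpow_le_rpow (by positivity) ?_ hq.le
      have : ((a + 1 : ℕ) : ℝ) ≤ d := by exact_mod_cast (by omega : a + 1 ≤ d)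
      push_cast at this
      linarith
    have h2 : (b : ℝ) / (d / ((d : ℝ) ^ q - ((d : ℝ) - 1) ^ q)) ≤
        (d : ℝ) ^ q - ((d : ℝ) - 1) ^ q := by
      rw [div_div_eq_mul_div, div_le_iff₀ (by linarith), mul_comm]
      refine mul_le_mul_of_nonneg_left ?_ hgap.le
      exact_mod_cast (by omega : b ≤ d)
    linarith

/-- The combinatorial core of the upper estimate: successive children `c`, each controlled by the
weights of the blocks that it meets, are jointly controlled by the weights of their parent. -/
theorem mul_sum_le_of_blockWeight {ι : Type*} [LinearOrder ι] {A : Finset ι} {d : ℕ} {θ r β : ℝ}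
    (hd : 2 ≤ d) (hr : 1 < r) (hdθ : (d : ℝ) * θ = (d : ℝ) ^ (1 / r)) (hβ : 1 ≤ β)
    (hβ' : ∀ a b : ℕ, a + b ≤ d → (a : ℝ) ^ (1 - 1 / r) + b / β ≤ (d : ℝ) ^ (1 - 1 / r))
    {s : Finset ℕ} {t : ℕ → ℝ} (ht : ∀ i, 0 ≤ t i) (hA : A.card ≤ d) {m' n' : ι → ℕ}
    {m n : ℕ} (hmn : m < n) (hs : ∀ c ∈ A, m' c ∈ s)
    (hle : ∀ c ∈ A, m' c ≤ n' c) (hord : ∀ c ∈ A, ∀ c' ∈ A, c < c' → n' c ≤ m' c')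
    (hm : ∀ c ∈ A, m ≤ m' c) (hn : ∀ c ∈ A, n' c ≤ n) {f : ι → ℝ}
    (hf : ∀ c ∈ A, f c ≤
      (∑ i ∈ s, blockWeight (β ^ r) (d + 2 * β ^ r) (m' c) (n' c) i * t i) ^ (1 / r)) :
    θ * ∑ c ∈ A, f c ≤
      (∑ i ∈ s, blockWeight (β ^ r) (d + 2 * β ^ r) m n i * t i) ^ (1 / r) := by
  classical
  have hd0 : (0 : ℝ) < d := by exact_mod_cast (by omega : 0 < d)
  have hB : (0 : ℝ) ≤ β ^ r := by positivity
  have hC : (0 : ℝ) ≤ d + 2 * β ^ r := by positivity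
  set B := β ^ r with hBdef
  set C := (d : ℝ) + 2 * B with hCdef
  have hnn : ∀ m n, ∀ i ∈ s, 0 ≤ blockWeight B C m n i * t i :=
    fun m n i _ => mul_nonneg (blockWeight_nonneg hB hC _ _ _) (ht i)
  set S := ∑ i ∈ s, blockWeight B C m n i * t i with hS
  have hS0 : 0 ≤ S := Finset.sum_nonneg (hnn m n)
  -- `U` collects the children confined to the first or the last block of the parent. Such a child
  -- is bounded by `t (m' c) ^ (1 / r)`, while the parent carries `B * t (m' c)`: a gain of the
  -- factor `β`.
  set U := A.filter fun c => m' c = n' c ∧ (m' c = m ∨ m' c = n) with hU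
  set V := A.filter fun c => ¬ (m' c = n' c ∧ (m' c = m ∨ m' c = n)) with hV
  have hVA : V ⊆ A := Finset.filter_subset _ _
  have hcard : V.card + U.card ≤ d := by
    rw [add_comm, hU, hV, Finset.card_filter_add_card_filter_not]
    exact hA
  have hsumV : ∑ c ∈ V, f c ≤ (V.card : ℝ) ^ (1 - 1 / r) * S ^ (1 / r) := by
    refine (sum_le_card_rpow_mul V hr (fun c _ => Finset.sum_nonneg (hnn (m' c) (n' c)))
      fun c hc => hf c (hVA hc)).trans ?_
    refine mul_le_mul_of_nonneg_left ?_ (by positivity)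
    refine Real.rpow_le_rpow
      (Finset.sum_nonneg fun c _ => Finset.sum_nonneg (hnn (m' c) (n' c))) ?_ (by positivity)
    rw [Finset.sum_comm]
    refine Finset.sum_le_sum fun i _ => ?_
    rw [← Finset.sum_mul]
    refine mul_le_mul_of_nonneg_right ?_ (ht i)
    exact sum_blockWeight_le hB le_rfl ((Finset.card_le_card hVA).trans hA) hmn
      (fun c hc => hle c (hVA hc)) (fun c hc c' hc' => hord c (hVA hc) c' (hVA hc'))
      (fun c hc => hm c (hVA hc)) (fun c hc => hn c (hVA hc))
      (fun c hc => (Finset.mem_filter.1 hc).2) i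
  have hsumU : ∑ c ∈ U, f c ≤ (U.card : ℝ) / β * S ^ (1 / r) := by
    have : ∀ c ∈ U, f c ≤ S ^ (1 / r) / β := by
      intro c hc
      obtain ⟨hcA, hc1, hc2⟩ := Finset.mem_filter.1 hc
      have hw : ∑ i ∈ s, blockWeight B C (m' c) (n' c) i * t i = t (m' c) := by
        rw [Finset.sum_eq_single_of_mem (m' c) (hs c hcA)]
        · simp [blockWeight, ← hc1]
        · intro i _ hi
          have h1 : m' c ≠ i := fun h => hi h.symm
          have h2 : ¬ (m' c < i ∧ i < m' c) := by omega
          simp [blockWeight, ← hc1, h1, h2]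
      have hle' : B * t (m' c) ≤ S := by
        have hw' : blockWeight B C m n (m' c) = B := by
          rcases hc2 with h | h
          · simp [blockWeight, h, hmn, hmn.ne']
          · simp [blockWeight, h, hmn, hmn.ne]
        rw [← hw']
        exact Finset.single_le_sum (f := fun i => blockWeight B C m n i * t i) (hnn m n)
          (hs c hcA)
      refine (hf c hcA).trans ?_
      rw [hw, le_div_iff₀ (by linarith)]
      have hβr : β = B ^ (1 / r) := by
        rw [hBdef, ← Real.rpow_mul (by linarith), mul_one_div_cancel (by linarith), Real.rpow_one]
      rw [hβr, ← Real.mul_rpow (ht _) hB, mul_comm]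
      exact Real.rpow_le_rpow (mul_nonneg hB (ht _)) hle' (by positivity)
    refine (Finset.sum_le_card_nsmul U f _ this).trans (le_of_eq ?_)
    rw [nsmul_eq_mul]
    ring
  have hsum : ∑ c ∈ A, f c = ∑ c ∈ U, f c + ∑ c ∈ V, f c :=
    (Finset.sum_filter_add_sum_filter_not A _ f).symm
  -- The choice of the exponent enters here: `θ` cancels exactly the Hölder factor of `d` children.
  have hθ : θ * (d : ℝ) ^ (1 - 1 / r) = 1 := by
    have h1 : (d : ℝ) ^ (1 - 1 / r) = d / ((d : ℝ) * θ) := by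
      rw [hdθ, Real.rpow_sub hd0, Real.rpow_one]
    have h2 : 0 < (d : ℝ) * θ := hdθ ▸ Real.rpow_pos_of_pos hd0 _
    rw [h1, mul_div_assoc', mul_comm θ, div_self h2.ne']
  have hθ0 : 0 ≤ θ := by
    have h2 : 0 < (d : ℝ) * θ := hdθ ▸ Real.rpow_pos_of_pos hd0 _
    exact (pos_of_mul_pos_right h2 hd0.le).le
  calc θ * ∑ c ∈ A, f c
      ≤ θ * (((V.card : ℝ) ^ (1 - 1 / r) + U.card / β) * S ^ (1 / r)) := by
        refine mul_le_mul_of_nonneg_left ?_ hθ0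
        rw [hsum]
        linarith
    _ ≤ θ * ((d : ℝ) ^ (1 - 1 / r) * S ^ (1 / r)) := by
        refine mul_le_mul_of_nonneg_left (mul_le_mul_of_nonneg_right (hβ' _ _ hcard) ?_) hθ0
        positivity
    _ = S ^ (1 / r) := by rw [← mul_assoc, hθ, one_mul]

/-! ### Combinations of successive vectors and their restrictions. -/

/-- The supports of the `x i` are successive. -/
def Successive {k : ℕ} (x : ℕ → Ome k →₀ ℝ) : Prop :=
  ∀ i i', i < i' → SetLT (x i).support (x i').support

theorem Successive.eq_of_mem {k : ℕ} {x : ℕ → Ome k →₀ ℝ} (hx : Successive x) {i i' : ℕ} {v : Ome k}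
    (h : v ∈ (x i).support) (h' : v ∈ (x i').support) : i = i' := by
  rcases lt_trichotomy i i' with h1 | h1 | h1
  · exact (Ome.lt_irrefl v (hx i i' h1 v h v h')).elim
  · exact h1
  · exact (Ome.lt_irrefl v (hx i' i h1 v h' v h)).elim

theorem Successive.sum_apply_of_mem {k : ℕ} {x : ℕ → Ome k →₀ ℝ} (hx : Successive x) {s : Finset ℕ}
    (a : ℕ → ℝ) {i : ℕ} (hi : i ∈ s) {v : Ome k} (hv : v ∈ (x i).support) :
    (∑ i ∈ s, a i • x i) v = a i * x i v := by
  rw [Finsupp.finsetSum_apply, Finset.sum_eq_single_of_mem i hi]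
  · rfl
  · intro i' _ hne
    have : v ∉ (x i').support := fun h => hne (hx.eq_of_mem h hv)
    simp [Finsupp.notMem_support_iff.1 this]

theorem sum_apply_of_notMem {k : ℕ} {x : ℕ → Ome k →₀ ℝ} {s : Finset ℕ}
    (a : ℕ → ℝ) {v : Ome k} (hv : ∀ i ∈ s, v ∉ (x i).support) :
    (∑ i ∈ s, a i • x i) v = 0 := by
  rw [Finsupp.finsetSum_apply]
  exact Finset.sum_eq_zero fun i hi => by simp [Finsupp.notMem_support_iff.1 (hv i hi)]

theorem restr_apply_of_mem {k : ℕ} {E : Finset (Ome k)} {x : Ome k →₀ ℝ} {v : Ome k} (h : v ∈ E) :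
    restr E x v = x v := by
  classical
  exact Finsupp.filter_apply_pos _ _ h

theorem restr_apply_of_notMem {k : ℕ} {E : Finset (Ome k)} {x : Ome k →₀ ℝ} {v : Ome k}
    (h : v ∉ E) : restr E x v = 0 := by
  classical
  exact Finsupp.filter_apply_neg _ _ h

theorem restr_restr {k : ℕ} [DecidableEq (Ome k)] (E F : Finset (Ome k)) (x : Ome k →₀ ℝ) :
    restr E (restr F x) = restr (E ∩ F) x := by
  ext v
  by_cases hE : v ∈ E <;> by_cases hF : v ∈ F
  · rw [restr_apply_of_mem hE, restr_apply_of_mem hF,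
      restr_apply_of_mem (Finset.mem_inter.2 ⟨hE, hF⟩)]
  · rw [restr_apply_of_mem hE, restr_apply_of_notMem hF,
      restr_apply_of_notMem fun h => hF (Finset.mem_inter.1 h).2]
  · rw [restr_apply_of_notMem hE, restr_apply_of_notMem fun h => hE (Finset.mem_inter.1 h).1]
  · rw [restr_apply_of_notMem hE, restr_apply_of_notMem fun h => hE (Finset.mem_inter.1 h).1]

theorem Admissible.lt {k d m : ℕ} {E : Fin m → Finset (Ome k)} (h : Admissible k d E)
    {i j : Fin m} (hij : i < j) : SetLT (E i) (E j) := by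
  obtain ⟨-, v, -, h1, h2⟩ := h
  exact fun a ha b hb => Ome.lt_of_lt_of_le (h2 i j hij a ha) (h1 j b hb)

section

variable {k d : ℕ} {θ : ℝ}

/-- Since `E` sees no block other than `m`, the restriction is dominated coordinatewise by `a m • x
m`. -/
theorem normStep_restr_le_abs (h0 : 0 ≤ θ) (h1 : θ ≤ 1) {x : ℕ → Ome k →₀ ℝ} (hx : Successive x)
    (hnorm : ∀ i, tNorm k d θ (x i) ≤ 1) {s : Finset ℕ} {a : ℕ → ℝ} {E : Finset (Ome k)} {m : ℕ}
    (hE : ∀ i ∈ s, ∀ v ∈ E, v ∈ (x i).support → i = m) (j : ℕ) :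
    normStep k d θ j (restr E (∑ i ∈ s, a i • x i)) ≤ |a m| := by
  have h2 : normStep k d θ j (a m • x m) ≤ |a m| := by
    refine (normStep_smul_le h0 h1 j _ _).trans ?_
    exact mul_le_of_le_one_right (abs_nonneg _)
      ((normStep_le_tNorm h0 h1 j (x m)).trans (hnorm m))
  refine (normStep_le_of_abs_le h0 h1 j fun v => ?_).trans h2
  by_cases hv : v ∈ E
  · rw [restr_apply_of_mem hv]
    by_cases hvs : ∃ i ∈ s, v ∈ (x i).support
    · obtain ⟨i, hi, hvi⟩ := hvs
      rw [hx.sum_apply_of_mem a hi hvi, hE i hi v hv hvi]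
      rfl
    · push Not at hvs
      rw [sum_apply_of_notMem a hvs, abs_zero]
      exact abs_nonneg _
  · rw [restr_apply_of_notMem hv, abs_zero]
    exact abs_nonneg _

theorem normStep_restr_eq_zero (h0 : 0 ≤ θ) (h1 : θ ≤ 1) {x : ℕ → Ome k →₀ ℝ} {s : Finset ℕ}
    {a : ℕ → ℝ} {E : Finset (Ome k)} (hE : ∀ i ∈ s, ∀ v ∈ E, v ∉ (x i).support) (j : ℕ) :
    normStep k d θ j (restr E (∑ i ∈ s, a i • x i)) = 0 := by
  refine le_antisymm ((normStep_le_oneNorm h0 h1 j _).trans (le_of_eq ?_)) (normStep_nonneg j _)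
  have : restr E (∑ i ∈ s, a i • x i) = 0 := by
    ext v
    by_cases hv : v ∈ E
    · rw [restr_apply_of_mem hv, sum_apply_of_notMem a fun i hi => hE i hi v hv]
      rfl
    · rw [restr_apply_of_notMem hv]
      rfl
  rw [this]
  simp [oneNorm]

/-- Induction on the stage `j`, for all sets and intervals at once. A set meeting a single block is
bounded by the norm of that block; for longer intervals the induction hypothesis applies to the
children, and `mul_sum_le_of_blockWeight` combines them. -/
theorem normStep_restr_le {r β : ℝ} (h0 : 0 ≤ θ) (h1 : θ ≤ 1) (hd : 2 ≤ d) (hr : 1 < r)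
    (hdθ : (d : ℝ) * θ = (d : ℝ) ^ (1 / r)) (hβ : 1 ≤ β)
    (hβ' : ∀ a b : ℕ, a + b ≤ d → (a : ℝ) ^ (1 - 1 / r) + b / β ≤ (d : ℝ) ^ (1 - 1 / r))
    {x : ℕ → Ome k →₀ ℝ} (hx : Successive x) (hnorm : ∀ i, tNorm k d θ (x i) ≤ 1)
    (s : Finset ℕ) (a : ℕ → ℝ) (j : ℕ) (E : Finset (Ome k)) (m n : ℕ) (hmn : m ≤ n)
    (hE : ∀ i ∈ s, ∀ v ∈ E, v ∈ (x i).support → m ≤ i ∧ i ≤ n) :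
    normStep k d θ j (restr E (∑ i ∈ s, a i • x i)) ≤
      (∑ i ∈ s, blockWeight (β ^ r) (d + 2 * β ^ r) m n i * |a i| ^ r) ^ (1 / r) := by
  classical
  have hB1 : (1 : ℝ) ≤ β ^ r := Real.one_le_rpow hβ (by linarith)
  have hC1 : (1 : ℝ) ≤ d + 2 * β ^ r := by
    have : (0 : ℝ) ≤ d := d.cast_nonneg
    linarith
  have hnn : ∀ m n, ∀ i ∈ s, 0 ≤ blockWeight (β ^ r) (d + 2 * β ^ r) m n i * |a i| ^ r :=
    fun m n i _ => mul_nonneg (blockWeight_nonneg (by linarith) (by linarith) _ _ _)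
      (Real.rpow_nonneg (abs_nonneg _) _)
  have hS0 : ∀ m n, 0 ≤
      (∑ i ∈ s, blockWeight (β ^ r) (d + 2 * β ^ r) m n i * |a i| ^ r) ^ (1 / r) :=
    fun m n => Real.rpow_nonneg (Finset.sum_nonneg (hnn m n)) _
  -- a block met by `E` is controlled by the sum
  have hsingle : ∀ m n i, i ∈ s → m ≤ i → i ≤ n → |a i| ≤
      (∑ i ∈ s, blockWeight (β ^ r) (d + 2 * β ^ r) m n i * |a i| ^ r) ^ (1 / r) := by
    intro m n i hi hmi hin
    have hw : 1 ≤ blockWeight (β ^ r) (d + 2 * β ^ r) m n i := by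
      rcases hmi.eq_or_lt with h | h <;> rcases hin.eq_or_lt with h' | h'
      · simp [blockWeight, h, h']
      · subst h
        simpa [blockWeight, h', h'.ne'] using hB1
      · subst h'
        simpa [blockWeight, h, h.ne] using hB1
      · simpa [blockWeight, h, h', h.ne, h'.ne'] using hC1
    calc |a i| = (|a i| ^ r) ^ (1 / r) := by
          rw [← Real.rpow_mul (abs_nonneg _), mul_one_div_cancel (by linarith), Real.rpow_one]
      _ ≤ _ := by
        refine Real.rpow_le_rpow (Real.rpow_nonneg (abs_nonneg _) _) ?_ (by positivity)
        refine le_trans ?_ (Finset.single_le_sum (hnn m n) hi)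
        exact le_mul_of_one_le_left (Real.rpow_nonneg (abs_nonneg _) _) hw
  induction j generalizing E m n with
  | zero =>
    refine Real.iSup_le (fun v => ?_) (hS0 m n)
    by_cases hv : v ∈ E
    · rw [restr_apply_of_mem hv]
      by_cases hvs : ∃ i ∈ s, v ∈ (x i).support
      · obtain ⟨i, hi, hvi⟩ := hvs
        rw [hx.sum_apply_of_mem a hi hvi, abs_mul]
        obtain ⟨h2, h3⟩ := hE i hi v hv hvi
        refine (mul_le_of_le_one_right (abs_nonneg _) ?_).trans (hsingle m n i hi h2 h3)
        exact (abs_le_tNorm h0 h1 _ _).trans (hnorm i)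
      · push Not at hvs
        rw [sum_apply_of_notMem a hvs, abs_zero]
        exact hS0 m n
    · rw [restr_apply_of_notMem hv, abs_zero]
      exact hS0 m n
  | succ j ih =>
    rcases hmn.eq_or_lt with rfl | hlt
    · by_cases hms : m ∈ s
      · refine (normStep_restr_le_abs h0 h1 hx hnorm (m := m) (fun i hi v hv hvi => ?_) _).trans
          (hsingle m m m hms le_rfl le_rfl)
        have := hE i hi v hv hvi
        omega
      · rw [normStep_restr_eq_zero h0 h1]
        · exact hS0 m m
        · intro i hi v hv hvi
          have := hE i hi v hv hvi
          have him : i = m := by omega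
          exact hms (him ▸ hi)
    · refine max_le (ih E m n hmn hE) ?_
      have hsup : ∀ l : ℕ, l ≤ d → ∀ F : Fin l → Finset (Ome k), Admissible k d F →
          θ * ∑ c, normStep k d θ j (restr (F c) (restr E (∑ i ∈ s, a i • x i))) ≤
            (∑ i ∈ s, blockWeight (β ^ r) (d + 2 * β ^ r) m n i * |a i| ^ r) ^ (1 / r) := by
        intro l hl F hF
        simp only [restr_restr]
        -- `I c` lists the blocks met by child `c`. Children meeting none contribute zero and are
        -- discarded, so that extreme indices exist for the rest.
        set I : Fin l → Finset ℕ := fun c => s.filter fun i => ∃ v ∈ F c ∩ E, v ∈ (x i).support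
          with hI
        set A : Finset (Fin l) := Finset.univ.filter fun c => (I c).Nonempty with hA
        have hIs : ∀ c, ∀ i ∈ I c, i ∈ s ∧ m ≤ i ∧ i ≤ n := by
          intro c i hi
          obtain ⟨his, v, hv, hvi⟩ := Finset.mem_filter.1 hi
          exact ⟨his, hE i his v (Finset.mem_inter.1 hv).2 hvi⟩
        -- The pair `(0, 0)` is a dummy value for children outside `A`.
        have hex : ∀ c, ∃ p : ℕ × ℕ, c ∈ A → p.1 ∈ I c ∧ p.2 ∈ I c ∧
            ∀ i ∈ I c, p.1 ≤ i ∧ i ≤ p.2 := by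
          intro c
          by_cases hc : (I c).Nonempty
          · exact ⟨((I c).min' hc, (I c).max' hc), fun _ => ⟨(I c).min'_mem hc, (I c).max'_mem hc,
              fun i hi => ⟨(I c).min'_le i hi, (I c).le_max' i hi⟩⟩⟩
          · exact ⟨(0, 0), fun h => absurd (Finset.mem_filter.1 h).2 hc⟩
        choose p hp using hex
        have hzero : ∑ c, normStep k d θ j (restr (F c ∩ E) (∑ i ∈ s, a i • x i)) =
            ∑ c ∈ A, normStep k d θ j (restr (F c ∩ E) (∑ i ∈ s, a i • x i)) := by
          refine (Finset.sum_subset (Finset.subset_univ A) fun c _ hc => ?_).symm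
          refine normStep_restr_eq_zero h0 h1 (fun i hi v hv hvi => hc ?_) j
          exact Finset.mem_filter.2 ⟨Finset.mem_univ _, i, Finset.mem_filter.2 ⟨hi, v, hv, hvi⟩⟩
        rw [hzero]
        refine mul_sum_le_of_blockWeight (m' := fun c => (p c).1) (n' := fun c => (p c).2) hd hr
          hdθ hβ hβ' (fun i => Real.rpow_nonneg (abs_nonneg _) _) ?_ hlt
          (fun c hc => (hIs c _ (hp c hc).1).1) (fun c hc => ((hp c hc).2.2 _ (hp c hc).1).2) ?_
          (fun c hc => (hIs c _ (hp c hc).1).2.1) (fun c hc => (hIs c _ (hp c hc).2.1).2.2) ?_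
        · refine (Finset.card_le_univ A).trans ?_
          rwa [Fintype.card_fin]
        -- Different children may share a block, so only the non-strict inequality can hold.
        · intro c hc c' hc' hcc
          by_contra! hcon
          obtain ⟨-, v, hv, hvi⟩ := Finset.mem_filter.1 (hp c hc).2.1
          obtain ⟨-, w, hw, hwi⟩ := Finset.mem_filter.1 (hp c' hc').1
          have h2 := hF.lt hcc v (Finset.mem_inter.1 hv).1 w (Finset.mem_inter.1 hw).1
          exact Ome.lt_irrefl _ (Ome.lt_trans h2 (hx _ _ hcon w hwi v hvi))
        · intro c hc
          refine ih (F c ∩ E) _ _ ((hp c hc).2.2 _ (hp c hc).1).2 fun i hi v hv hvi => ?_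
          exact (hp c hc).2.2 i (Finset.mem_filter.2 ⟨hi, v, hv, hvi⟩)
      rcases h0.eq_or_lt with rfl | hpos
      · rw [zero_mul]
        exact hS0 m n
      · rw [← le_div_iff₀' hpos]
        refine Real.sSup_le ?_ (div_nonneg (hS0 m n) h0)
        rintro _ ⟨l, -, hl, F, hF, rfl⟩
        rw [le_div_iff₀' hpos]
        exact hsup l hl F hF

/-- Successive vectors in the unit ball of `T(𝓐_d^k, θ)` satisfy an upper `ℓ_r`-estimate. -/
theorem exists_tNorm_sum_le {r : ℝ} (h0 : 0 ≤ θ) (h1 : θ ≤ 1) (hd : 2 ≤ d) (hr : 1 < r)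
    (hdθ : (d : ℝ) * θ = (d : ℝ) ^ (1 / r)) {x : ℕ → Ome k →₀ ℝ} (hx : Successive x)
    (hnorm : ∀ i, tNorm k d θ (x i) ≤ 1) :
    ∃ C : ℝ, 0 < C ∧ ∀ (s : Finset ℕ) (a : ℕ → ℝ),
      tNorm k d θ (∑ i ∈ s, a i • x i) ≤ C * (∑ i ∈ s, |a i| ^ r) ^ (1 / r) := by
  have hr0 : 0 < 1 / r := by positivity
  obtain ⟨β, hβ, hβ'⟩ := exists_end_constant hd (q := 1 - 1 / r)
    (sub_pos.2 ((div_lt_one (by linarith)).2 hr)) (by linarith)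
  have hB1 : (1 : ℝ) ≤ β ^ r := Real.one_le_rpow hβ (by linarith)
  have hC : (0 : ℝ) < d + 2 * β ^ r := by positivity
  refine ⟨(d + 2 * β ^ r) ^ (1 / r), Real.rpow_pos_of_pos hC _, fun s a => ?_⟩
  refine ciSup_le fun j => ?_
  set X := ∑ i ∈ s, a i • x i with hX
  have hres : restr X.support X = X := by
    ext v
    by_cases hv : v ∈ X.support
    · exact restr_apply_of_mem hv
    · rw [restr_apply_of_notMem hv, Finsupp.notMem_support_iff.1 hv]
  -- The right end `s.sup id + 1` lies beyond every index of `s`, so all blocks have interior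
  -- weight, except block `0`, whose weight is smaller.
  have h := normStep_restr_le h0 h1 hd hr hdθ hβ hβ' hx hnorm s a j X.support 0 (s.sup id + 1)
    (Nat.zero_le _) fun i hi v _ _ =>
      ⟨Nat.zero_le _, (Finset.le_sup (f := id) hi).trans (Nat.le_succ _)⟩
  rw [← hX, hres] at h
  refine h.trans ?_
  rw [← Real.mul_rpow hC.le (Finset.sum_nonneg fun i _ => Real.rpow_nonneg (abs_nonneg _) _),
    Finset.mul_sum]
  refine Real.rpow_le_rpow (Finset.sum_nonneg fun i _ => mul_nonneg
    (blockWeight_nonneg (by linarith) hC.le _ _ _) (Real.rpow_nonneg (abs_nonneg _) _)) ?_ hr0.le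
  refine Finset.sum_le_sum fun i hi => mul_le_mul_of_nonneg_right ?_
    (Real.rpow_nonneg (abs_nonneg _) _)
  have hi' : i < s.sup id + 1 := Nat.lt_succ_of_le (Finset.le_sup (f := id) hi)
  have hd0 : (0 : ℝ) ≤ d := d.cast_nonneg
  rcases Nat.eq_zero_or_pos i with rfl | hpos
  · simp [blockWeight]
    linarith
  · simp only [blockWeight, hi', hpos, hpos.ne, hi'.ne']
    simp

end

/-! ### Lower `ℓ_r`-estimates from splittings into at most `d` consecutive pieces -/

section

variable {d : ℕ} {θ : ℝ} {N : Finset ℕ → ℝ} {b : ℕ → ℝ} {s : Finset ℕ}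

/-- Induction on the number `h` of remaining levels, with `W` inside the `d`-adic cell `j` of level
`l`. If some `i ∈ W` has `n i = l`, its cell holds no other point and `W = {i}`. Otherwise the next
base-`d` digit splits `W` into consecutive pieces, each in a cell of level `l + 1`, at the price of
one factor `θ`. -/
theorem sum_pow_depth_mul_le (hd : 0 < d) (h0 : 0 ≤ θ) (hN0 : ∀ W, 0 ≤ N W)
    (hN1 : ∀ i ∈ s, b i ≤ N {i})
    (hN2 : ∀ W ⊆ s, ∀ χ : ℕ → ℕ, MonotoneOn χ W → (∀ i ∈ W, χ i < d) →
      θ * ∑ c ∈ Finset.range d, N (W.filter (χ · = c)) ≤ N W)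
    {z : ℕ → ℝ} (hz : MonotoneOn z s) {n : ℕ → ℕ}
    (hsep : ∀ i ∈ s, ∀ i' ∈ s, ⌊(d : ℝ) ^ n i * z i⌋₊ = ⌊(d : ℝ) ^ n i * z i'⌋₊ → i = i')
    (h l : ℕ) {W : Finset ℕ} (hW : W ⊆ s) (j : ℕ)
    (hl : ∀ i ∈ W, l ≤ n i ∧ n i ≤ l + h ∧ ⌊(d : ℝ) ^ l * z i⌋₊ = j) :
    ∑ i ∈ W, θ ^ n i * b i ≤ θ ^ l * N W := by
  have hsing : ∀ (l : ℕ) {W : Finset ℕ}, W ⊆ s → ∀ j, (∀ i ∈ W, ⌊(d : ℝ) ^ l * z i⌋₊ = j) →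
      ∀ i ∈ W, n i = l → ∑ i ∈ W, θ ^ n i * b i ≤ θ ^ l * N W := by
    intro l W hW j hj i hi hil
    have hWi : W = {i} := by
      refine Finset.eq_singleton_iff_unique_mem.2 ⟨hi, fun i' hi' => ?_⟩
      refine (hsep i (hW hi) i' (hW hi') ?_).symm
      rw [hil, hj i hi, hj i' hi']
    rw [hWi, Finset.sum_singleton, hil]
    exact mul_le_mul_of_nonneg_left (hN1 i (hW hi)) (pow_nonneg h0 l)
  induction h generalizing l W j with
  | zero =>
    rcases W.eq_empty_or_nonempty with rfl | ⟨i, hi⟩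
    · rw [Finset.sum_empty]
      exact mul_nonneg (pow_nonneg h0 l) (hN0 _)
    · exact hsing l hW j (fun i hi => (hl i hi).2.2) i hi (by have := hl i hi; omega)
  | succ h ih =>
    by_cases hex : ∃ i ∈ W, n i = l
    · obtain ⟨i, hi, hil⟩ := hex
      exact hsing l hW j (fun i hi => (hl i hi).2.2) i hi hil
    push Not at hex
    -- Passing from a cell to its parent drops the last base-`d` digit.
    have hdiv : ∀ i ∈ W, ⌊(d : ℝ) ^ (l + 1) * z i⌋₊ / d = j := by
      intro i hi
      rw [← Nat.floor_div_natCast, pow_succ, mul_right_comm, mul_div_assoc, div_self, mul_one,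
        (hl i hi).2.2]
      exact_mod_cast hd.ne'
    set χ : ℕ → ℕ := fun i => ⌊(d : ℝ) ^ (l + 1) * z i⌋₊ % d with hχ
    have hfl : ∀ i ∈ W, ⌊(d : ℝ) ^ (l + 1) * z i⌋₊ = d * j + χ i := by
      intro i hi
      rw [← hdiv i hi]
      exact (Nat.div_add_mod _ _).symm
    have hlt : ∀ i ∈ W, χ i < d := fun i _ => Nat.mod_lt _ hd
    have hmono : MonotoneOn χ W := by
      intro i hi i' hi' hii
      have h1 : ⌊(d : ℝ) ^ (l + 1) * z i⌋₊ ≤ ⌊(d : ℝ) ^ (l + 1) * z i'⌋₊ :=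
        Nat.floor_le_floor (mul_le_mul_of_nonneg_left (hz (hW hi) (hW hi') hii) (by positivity))
      rw [hfl i hi, hfl i' hi'] at h1
      omega
    have hpiece : ∀ c ∈ Finset.range d, ∑ i ∈ W.filter (χ · = c), θ ^ n i * b i ≤
        θ ^ (l + 1) * N (W.filter (χ · = c)) := by
      intro c _
      have hsub : W.filter (χ · = c) ⊆ W := Finset.filter_subset _ _
      have hl' : ∀ i ∈ W.filter (χ · = c), l + 1 ≤ n i ∧ n i ≤ l + 1 + h ∧
          ⌊(d : ℝ) ^ (l + 1) * z i⌋₊ = d * j + c := by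
        intro i hi
        obtain ⟨hiW, hic⟩ := Finset.mem_filter.1 hi
        have h1 := hl i hiW
        have h2 := hex i hiW
        refine ⟨by omega, by omega, ?_⟩
        rw [hfl i hiW, hic]
      exact ih (l + 1) (hsub.trans hW) (d * j + c) hl'
    calc ∑ i ∈ W, θ ^ n i * b i
        = ∑ c ∈ Finset.range d, ∑ i ∈ W.filter (χ · = c), θ ^ n i * b i :=
          (Finset.sum_fiberwise_of_maps_to (fun i hi => Finset.mem_range.2 (hlt i hi)) _).symm
      _ ≤ ∑ c ∈ Finset.range d, θ ^ (l + 1) * N (W.filter (χ · = c)) :=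
          Finset.sum_le_sum hpiece
      _ = θ ^ l * (θ * ∑ c ∈ Finset.range d, N (W.filter (χ · = c))) := by
          rw [← Finset.mul_sum, pow_succ, mul_assoc]
      _ ≤ θ ^ l * N W := mul_le_mul_of_nonneg_left (hN2 W hW χ hmono hlt) (pow_nonneg h0 l)

/-- Positive masses of total at most `1` can be placed in order at points of `[0, 1)` so that the
point carrying the mass `w i` is separated from the others by the `d`-adic cells of level `n i`,
where `d ^ n i` is comparable to `1 / w i`. -/
theorem exists_separated_points (hd : 2 ≤ d) {w : ℕ → ℝ} (hw : ∀ i ∈ s, 0 < w i)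
    (hsum : ∑ i ∈ s, w i ≤ 1) :
    ∃ (z : ℕ → ℝ) (n : ℕ → ℕ), MonotoneOn z s ∧ (∀ i ∈ s, 0 ≤ z i ∧ z i < 1) ∧
      (∀ i ∈ s, ∀ i' ∈ s, ⌊(d : ℝ) ^ n i * z i⌋₊ = ⌊(d : ℝ) ^ n i * z i'⌋₊ → i = i') ∧
      ∀ i ∈ s, w i * (d : ℝ) ^ n i ≤ 2 * d := by
  have hd1 : (1 : ℝ) < d := by exact_mod_cast (by omega : 1 < d)
  have hex : ∀ i, ∃ n : ℕ, i ∈ s → 2 < w i * (d : ℝ) ^ n ∧ w i * (d : ℝ) ^ n ≤ 2 * d := by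
    intro i
    by_cases hi : i ∈ s
    · have hwi := hw i hi
      have h1 : w i ≤ 1 :=
        (Finset.single_le_sum (f := w) (fun j hj => (hw j hj).le) hi).trans hsum
      -- From `d ^ n ≤ 2 / w i < d ^ (n + 1)`, the cells of level `n + 1` are shorter than `w i / 2`
      -- but not shorter than `w i / (2 * d)`.
      obtain ⟨n, hn, hn'⟩ := exists_nat_pow_near (x := 2 / w i) (y := (d : ℝ))
        (by rw [le_div_iff₀ hwi]; linarith) hd1
      rw [le_div_iff₀ hwi] at hn
      rw [div_lt_iff₀ hwi] at hn'
      refine ⟨n + 1, fun _ => ⟨by linarith, ?_⟩⟩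
      rw [pow_succ]
      nlinarith
    · exact ⟨0, fun h => absurd h hi⟩
  choose n hn using hex
  -- Consecutive intervals of lengths `w i` start at `0`, and `z i` is the midpoint of its interval;
  -- every other point is then at distance at least `w i / 2`.
  set z : ℕ → ℝ := fun i => ∑ i' ∈ s.filter (· < i), w i' + w i / 2 with hz
  have hstep : ∀ i ∈ s, ∀ i' ∈ s, i < i' → z i + w i / 2 + w i' / 2 ≤ z i' := by
    intro i hi i' hi' hii
    have h1 : ∑ j ∈ s.filter (· < i), w j + w i ≤ ∑ j ∈ s.filter (· < i'), w j := by
      rw [add_comm, ← Finset.sum_insert (by simp)]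
      refine Finset.sum_le_sum_of_subset_of_nonneg ?_ fun j hj _ =>
        (hw j (Finset.mem_filter.1 hj).1).le
      intro j hj
      rw [Finset.mem_insert, Finset.mem_filter] at hj
      rw [Finset.mem_filter]
      rcases hj with rfl | ⟨h2, h3⟩
      exacts [⟨hi, hii⟩, ⟨h2, h3.trans hii⟩]
    simp only [hz]
    linarith
  have hz0 : ∀ i ∈ s, 0 ≤ z i := fun i hi => add_nonneg
    (Finset.sum_nonneg fun j hj => (hw j (Finset.mem_filter.1 hj).1).le) (half_pos (hw i hi)).le
  have hsepd : ∀ i ∈ s, ∀ i' ∈ s, i ≠ i' → 1 ≤ |(d : ℝ) ^ n i * z i - (d : ℝ) ^ n i * z i'| := by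
    intro i hi i' hi' hne
    have hpos : (0 : ℝ) < (d : ℝ) ^ n i := by positivity
    rw [← mul_sub, abs_mul, abs_of_pos hpos]
    have h1 : w i / 2 ≤ |z i - z i'| := by
      rcases lt_or_gt_of_ne hne with h | h
      · have h2 := hstep i hi i' hi' h
        have h3 := hw i' hi'
        rw [abs_sub_comm]
        exact le_trans (by linarith) (le_abs_self _)
      · have h2 := hstep i' hi' i hi h
        have h3 := hw i' hi'
        exact le_trans (by linarith) (le_abs_self _)
    have h2 := mul_le_mul_of_nonneg_left h1 hpos.le
    have h3 := (hn i hi).1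
    linarith
  refine ⟨z, n, ?_, fun i hi => ⟨hz0 i hi, ?_⟩, ?_, fun i hi => (hn i hi).2⟩
  · intro i hi i' hi' hii
    rcases hii.eq_or_lt with rfl | h
    · exact le_rfl
    · have h2 := hstep i hi i' hi' h
      have h3 := hw i hi
      have h4 := hw i' hi'
      linarith
  · have h1 : ∑ j ∈ s.filter (· < i), w j + w i ≤ ∑ j ∈ s, w j := by
      rw [add_comm, ← Finset.sum_insert (by simp)]
      refine Finset.sum_le_sum_of_subset_of_nonneg ?_ fun j hj _ => (hw j hj).le
      exact Finset.insert_subset hi (Finset.filter_subset _ _)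
    have h2 := hw i hi
    simp only [hz]
    linarith
  · intro i hi i' hi' heq
    by_contra hne
    have hpos : (0 : ℝ) ≤ (d : ℝ) ^ n i := by positivity
    have h1 := hsepd i hi i' hi' hne
    have h2 := Nat.floor_le (mul_nonneg hpos (hz0 i hi))
    have h3 := Nat.lt_floor_add_one ((d : ℝ) ^ n i * z i)
    have h4 := Nat.floor_le (mul_nonneg hpos (hz0 i' hi'))
    have h5 := Nat.lt_floor_add_one ((d : ℝ) ^ n i * z i')
    rw [heq] at h2 h3
    rcases le_abs.1 h1 with h | h <;> linarith

/-- Use the masses `w i = b i ^ r / S`. Since `θ = d ^ (-(1 - 1/r))` and `d ^ n i ≤ 2 * d / w i`,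
each term `θ ^ n i * b i` is at least `w i * S ^ (1/r) / (2 * d)`, and the masses sum to `1`. -/
theorem sum_rpow_le_of_splitting {r : ℝ} (hd : 2 ≤ d) (hr : 1 < r)
    (hdθ : (d : ℝ) * θ = (d : ℝ) ^ (1 / r)) (hb : ∀ i, 0 ≤ b i) (hN0 : ∀ W, 0 ≤ N W)
    (hN : ∀ W ⊆ s, N W ≤ N s) (hN1 : ∀ i ∈ s, b i ≤ N {i})
    (hN2 : ∀ W ⊆ s, ∀ χ : ℕ → ℕ, MonotoneOn χ W → (∀ i ∈ W, χ i < d) →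
      θ * ∑ c ∈ Finset.range d, N (W.filter (χ · = c)) ≤ N W) :
    ∑ i ∈ s, b i ^ r ≤ (2 * d * N s) ^ r := by
  have hd0 : (0 : ℝ) < d := by exact_mod_cast (by omega : 0 < d)
  have hd1 : (1 : ℝ) ≤ d := by exact_mod_cast (by omega : 1 ≤ d)
  have hr0 : 0 < r := by linarith
  have hr1 : 0 < 1 - 1 / r := sub_pos.2 ((div_lt_one hr0).2 hr)
  have hr2 : 0 < 1 / r := by positivity
  have hθ : θ = ((d : ℝ) ^ (1 - 1 / r))⁻¹ := by
    rw [← Real.rpow_neg hd0.le, neg_sub, Real.rpow_sub hd0, Real.rpow_one, ← hdθ,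
      mul_div_cancel_left₀ _ hd0.ne']
  have h0 : 0 ≤ θ := by rw [hθ]; positivity
  set S := ∑ i ∈ s, b i ^ r with hS
  have hS0 : 0 ≤ S := Finset.sum_nonneg fun i _ => Real.rpow_nonneg (hb i) r
  rcases hS0.eq_or_lt with h | hSpos
  · rw [← h]
    have := hN0 s
    positivity
  -- Vanishing coefficients carry no mass, and no finite depth would be assigned to them.
  set s' := s.filter fun i => 0 < b i with hs'
  have hss : s' ⊆ s := Finset.filter_subset _ _
  have hS' : ∑ i ∈ s', b i ^ r = S := by
    refine Finset.sum_subset hss fun i hi hi' => ?_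
    have : b i = 0 := by
      by_contra hne
      exact hi' (Finset.mem_filter.2 ⟨hi, lt_of_le_of_ne (hb i) (Ne.symm hne)⟩)
    rw [this, Real.zero_rpow hr0.ne']
  set w : ℕ → ℝ := fun i => b i ^ r / S with hw
  have hwsum : ∑ i ∈ s', w i = 1 := by
    rw [← Finset.sum_div, hS', div_self hSpos.ne']
  have hwpos : ∀ i ∈ s', 0 < w i := fun i hi =>
    div_pos (Real.rpow_pos_of_pos (Finset.mem_filter.1 hi).2 r) hSpos
  obtain ⟨z, n, hzm, hz01, hsep, hn⟩ := exists_separated_points hd hwpos hwsum.le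
  have key : ∑ i ∈ s', θ ^ n i * b i ≤ N s' := by
    have := sum_pow_depth_mul_le (N := N) (b := b) (by omega) h0 hN0
      (fun i hi => hN1 i (hss hi)) (fun W hW => hN2 W (hW.trans hss)) hzm hsep
      (s'.sup n) 0 (subset_refl s') 0 fun i hi => ⟨Nat.zero_le _, by
        rw [zero_add]; exact Finset.le_sup hi, by
        rw [pow_zero, one_mul, Nat.floor_eq_zero]; exact (hz01 i hi).2⟩
    simpa using this
  have hterm : ∀ i ∈ s', w i * S ^ (1 / r) ≤ 2 * d * (θ ^ n i * b i) := by
    intro i hi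
    have hwi := hwpos i hi
    have hbi : b i = w i ^ (1 / r) * S ^ (1 / r) := by
      rw [← Real.mul_rpow hwi.le hS0, hw]
      simp only
      rw [div_mul_cancel₀ _ hSpos.ne', ← Real.rpow_mul (hb i), mul_one_div_cancel hr0.ne',
        Real.rpow_one]
    have hθn : θ ^ n i = (((d : ℝ) ^ n i) ^ (1 - 1 / r))⁻¹ := by
      rw [hθ, inv_pow, ← Real.rpow_natCast, ← Real.rpow_mul hd0.le, mul_comm, Real.rpow_mul hd0.le,
        Real.rpow_natCast]
    have hwsplit : w i = w i ^ (1 - 1 / r) * w i ^ (1 / r) := by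
      rw [← Real.rpow_add hwi, sub_add_cancel, Real.rpow_one]
    have hmain : w i ^ (1 - 1 / r) ≤ 2 * d * θ ^ n i := by
      rw [hθn, ← div_eq_mul_inv, le_div_iff₀ (by positivity),
        ← Real.mul_rpow hwi.le (by positivity)]
      calc (w i * (d : ℝ) ^ n i) ^ (1 - 1 / r) ≤ (2 * d) ^ (1 - 1 / r) :=
            Real.rpow_le_rpow (by positivity) (hn i hi) hr1.le
        _ ≤ (2 * d) ^ (1 : ℝ) :=
            Real.rpow_le_rpow_of_exponent_le (by linarith) (by linarith)
        _ = 2 * d := Real.rpow_one _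
    calc w i * S ^ (1 / r) = w i ^ (1 - 1 / r) * (w i ^ (1 / r) * S ^ (1 / r)) := by
          rw [← mul_assoc, ← hwsplit]
      _ ≤ 2 * d * θ ^ n i * (w i ^ (1 / r) * S ^ (1 / r)) :=
          mul_le_mul_of_nonneg_right hmain (by positivity)
      _ = 2 * d * (θ ^ n i * b i) := by rw [hbi, mul_assoc (2 * (d : ℝ))]
  have hfin : S ^ (1 / r) ≤ 2 * d * N s := by
    calc S ^ (1 / r) = ∑ i ∈ s', w i * S ^ (1 / r) := by rw [← Finset.sum_mul, hwsum, one_mul]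
      _ ≤ ∑ i ∈ s', 2 * d * (θ ^ n i * b i) := Finset.sum_le_sum hterm
      _ = 2 * d * ∑ i ∈ s', θ ^ n i * b i := (Finset.mul_sum _ _ _).symm
      _ ≤ 2 * d * N s := mul_le_mul_of_nonneg_left (key.trans (hN s' hss)) (by positivity)
  calc S = (S ^ (1 / r)) ^ r := by
        rw [← Real.rpow_mul hS0, one_div_mul_cancel hr0.ne', Real.rpow_one]
    _ ≤ (2 * d * N s) ^ r := Real.rpow_le_rpow (by positivity) hfin hr0.le

end

/-! ### Trees given by strictly `≺`-monotone labels -/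

theorem getLastD_eq_getElem {s : List ℕ} (hs : s ≠ []) :
    s.getLastD 0 = s[s.length - 1]'(by have := List.length_pos_iff.2 hs; omega) := by
  rw [List.getLastD_eq_getLast?, List.getLast?_eq_getLast_of_ne_nil hs, Option.getD_some,
    List.getLast_eq_getElem]

theorem getElem_le_getLastD {s : List ℕ} (h : s.Pairwise (· ≤ ·)) {i : ℕ} (hi : i < s.length) :
    s[i] ≤ s.getLastD 0 := by
  have hs : s ≠ [] := List.ne_nil_of_length_pos (by omega)
  rw [List.getLastD_eq_getLast?, List.getLast?_eq_getLast_of_ne_nil hs, Option.getD_some]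
  exact h.rel_getLast (List.getElem_mem hi)

theorem lt_of_initSeg {s t : List ℕ} (h : InitSeg s t) : s < t := by
  obtain ⟨⟨u, rfl⟩, hne⟩ := h
  have hu : u ≠ [] := by rintro rfl; simp at hne
  clear hne
  induction s with
  | nil => cases u with
    | nil => exact absurd rfl hu
    | cons a u => exact List.nil_lt_cons a u
  | cons a s ih => exact List.cons_lt_cons_iff.2 (Or.inr ⟨rfl, ih⟩)

theorem prec_of_initSeg {s t : List ℕ} (ht : t.Pairwise (· ≤ ·)) (h : InitSeg s t) : Prec s t := by
  have hlt := lt_of_initSeg h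
  have ht' : t ≠ [] := by rintro rfl; exact h.2 (List.prefix_nil.1 h.1)
  by_cases hs : s = []
  · exact Or.inl ⟨hs, ht'⟩
  · have hle : s.getLastD 0 ≤ t.getLastD 0 := by
      rw [getLastD_eq_getElem hs, h.1.getElem]
      exact getElem_le_getLastD ht _
    exact Or.inr ⟨hs, ht', hle.lt_or_eq.imp_right fun h => ⟨h, hlt⟩⟩

/-- The sequence of the labels of the nonempty initial segments of `s`. -/
def labelSeq (g : List ℕ → ℕ) (s : List ℕ) : List ℕ :=
  (List.range s.length).map fun i => g (s.take (i + 1))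

theorem length_labelSeq (g : List ℕ → ℕ) (s : List ℕ) : (labelSeq g s).length = s.length := by
  simp [labelSeq]

theorem labelSeq_ne_nil (g : List ℕ → ℕ) {s : List ℕ} (hs : s ≠ []) : labelSeq g s ≠ [] := by
  rw [← List.length_pos_iff, length_labelSeq]
  exact List.length_pos_iff.2 hs

theorem getLastD_labelSeq (g : List ℕ → ℕ) {s : List ℕ} (hs : s ≠ []) :
    (labelSeq g s).getLastD 0 = g s := by
  have := List.length_pos_iff.2 hs
  rw [getLastD_eq_getElem (labelSeq_ne_nil g hs)]
  simp [labelSeq, Nat.sub_add_cancel this]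

theorem labelSeq_prefix (g : List ℕ → ℕ) {s t : List ℕ} (h : s <+: t) :
    labelSeq g s <+: labelSeq g t := by
  rw [List.prefix_iff_getElem]
  refine ⟨by simpa [length_labelSeq] using h.length_le, fun i hi => ?_⟩
  rw [length_labelSeq] at hi
  obtain ⟨u, rfl⟩ := h
  simp [labelSeq, List.take_append_of_le_length (Nat.succ_le_of_lt hi)]

/-- `g` is strictly monotone with respect to `≺`. -/
def PrecMono (k : ℕ) (g : List ℕ → ℕ) : Prop :=
  ∀ s t : Omle k, Prec s.1 t.1 → g s.1 < g t.1

theorem PrecMono.pairwise_labelSeq {k : ℕ} {g : List ℕ → ℕ} (hg : PrecMono k g) (s : Omle k) :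
    (labelSeq g s.1).Pairwise (· ≤ ·) := by
  rw [List.pairwise_iff_getElem]
  intro i j hi hj hij
  rw [length_labelSeq] at hi hj
  simp only [labelSeq, List.getElem_map, List.getElem_range]
  refine (hg ⟨s.1.take (i + 1), s.2.1.sublist (List.take_sublist _ _),
    (List.length_take_le' _ _).trans s.2.2⟩ ⟨s.1.take (j + 1), s.2.1.sublist (List.take_sublist _ _),
    (List.length_take_le' _ _).trans s.2.2⟩ ?_).le
  refine prec_of_initSeg (s.2.1.sublist (List.take_sublist _ _)) ⟨?_, ?_⟩
  · exact List.take_prefix_take_left (by omega)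
  · intro h
    have := congrArg List.length h
    simp only [List.length_take] at this
    omega

/-- The tree with labels `g`. -/
def labelTree {k : ℕ} {g : List ℕ → ℕ} (hg : PrecMono k g) (s : Omle k) : Omle k :=
  ⟨labelSeq g s.1, hg.pairwise_labelSeq s, (length_labelSeq g s.1).trans_le s.2.2⟩

/-- The image of a nonempty `s` ends in the label `g s`, so strict monotonicity of `g` already
separates last terms and no lexicographic comparison arises. -/
theorem isEllentuckTree_labelTree {k : ℕ} {g : List ℕ → ℕ} (hg : PrecMono k g) :
    IsEllentuckTree (labelTree hg) := by
  refine ⟨fun s t h => ?_, fun s t h => ⟨labelSeq_prefix g h.1, fun heq => ?_⟩⟩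
  · have ht : t.1 ≠ [] := by
      rcases h with h | h
      exacts [h.2, h.2.1]
    by_cases hs : s.1 = []
    · refine Or.inl ⟨?_, labelSeq_ne_nil g ht⟩
      simp [labelTree, labelSeq, hs]
    · apply prec_of_last_lt
      change (labelSeq g s.1).getLastD 0 < (labelSeq g t.1).getLastD 0
      rw [getLastD_labelSeq g hs, getLastD_labelSeq g ht]
      exact hg s t h
  · have hlen : s.1.length = t.1.length := by
      rw [← length_labelSeq g s.1, ← length_labelSeq g t.1]
      exact congrArg List.length heq
    exact h.2 (h.1.eq_of_length hlen)

/-! ### The spaces `X_v^max` -/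

theorem length_maxTree {v t : List ℕ} (h : t.length ≤ v.length) :
    (maxTree v t).length = t.length := by
  simp [maxTree, h]

theorem pairwise_maxTree {v t : List ℕ} (hv : v.Pairwise (· ≤ ·)) (ht : t.Pairwise (· ≤ ·)) :
    (maxTree v t).Pairwise (· ≤ ·) := by
  rw [List.pairwise_iff_getElem]
  intro i j hi hj hij
  have hi' : i < v.length ∧ i < t.length := by simpa [maxTree] using hi
  have hj' : j < v.length ∧ j < t.length := by simpa [maxTree] using hj
  have h1 := List.pairwise_iff_getElem.1 hv i j hi'.1 hj'.1 hij
  have h2 := List.pairwise_iff_getElem.1 ht i j hi'.2 hj'.2 hij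
  have h3 := getElem_le_getLastD hv hi'.1
  simp only [maxTree, List.getElem_zipWith]
  split_ifs <;> omega

theorem getLastD_maxTree {v t : List ℕ} (ht : t ≠ []) (h : t.length ≤ v.length) :
    (maxTree v t).getLastD 0 =
      if t.getLastD 0 = 0 then v.getD (t.length - 1) 0 else v.getLastD 0 + t.getLastD 0 := by
  have hpos := List.length_pos_iff.2 ht
  have hne : maxTree v t ≠ [] := by
    rw [← List.length_pos_iff, length_maxTree h]
    exact hpos
  rw [getLastD_eq_getElem hne, getLastD_eq_getElem ht, List.getD_eq_getElem _ _ (by omega)]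
  simp only [length_maxTree h]
  simp only [maxTree, List.getElem_zipWith]

/-- Every `f_j` is strictly increasing: at positive arguments its values exceed the last, hence
largest, term of `v`. -/
theorem maxTree_lt {v s t : List ℕ} (hv : v.Pairwise (· ≤ ·)) (hs : s.length ≤ v.length)
    (ht : t.length ≤ v.length) (h : s < t) : maxTree v s < maxTree v t := by
  have key : ∀ (L : ℕ) (v s t : List ℕ), (∀ n ∈ v, n ≤ L) → s.length ≤ v.length →
      t.length ≤ v.length → s < t →
      List.zipWith (fun n m => if m = 0 then n else L + m) v s <
        List.zipWith (fun n m => if m = 0 then n else L + m) v t := by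
    intro L v
    induction v with
    | nil =>
      intro s t _ hs ht h
      rw [List.length_nil, Nat.le_zero, List.length_eq_zero_iff] at hs ht
      subst hs ht
      exact absurd h (lt_irrefl _)
    | cons n v ih =>
      intro s t hL hs ht h
      cases t with
      | nil => exact absurd h (List.not_lt_nil s)
      | cons b t =>
        cases s with
        | nil => exact List.nil_lt_cons _ _
        | cons a s =>
          have hn := hL n (List.mem_cons_self ..)
          simp only [List.zipWith_cons_cons]
          rw [List.cons_lt_cons_iff] at h ⊢
          rcases h with h | ⟨rfl, h⟩
          · left
            split_ifs <;> omega
          · exact Or.inr ⟨rfl, ih s t (fun m hm => hL m (List.mem_cons_of_mem _ hm))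
              (by simpa using hs) (by simpa using ht) h⟩
  refine key _ v s t (fun n hn => ?_) hs ht h
  obtain ⟨i, hi, rfl⟩ := List.getElem_of_mem hn
  exact getElem_le_getLastD hv hi

theorem eq_replicate_of_getLastD_eq_zero {s : List ℕ} (hs : s.Pairwise (· ≤ ·))
    (h : s.getLastD 0 = 0) : s = List.replicate s.length 0 := by
  rw [List.eq_replicate_iff]
  refine ⟨rfl, fun a ha => ?_⟩
  obtain ⟨i, hi, rfl⟩ := List.getElem_of_mem ha
  have := getElem_le_getLastD hs hi
  omega

/-- Distinct last terms stay in order because a positive one is sent above all terms of `v`. The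
delicate case is that of two last terms `0`, where the value `f_j(0) = n_j` depends on the position
`j`. -/
theorem maxTree_prec {v s t : List ℕ} (hv : v.Pairwise (· ≤ ·)) (hsm : s.Pairwise (· ≤ ·))
    (htm : t.Pairwise (· ≤ ·)) (hs : s.length ≤ v.length) (ht : t.length ≤ v.length)
    (h : Prec s t) : Prec (maxTree v s) (maxTree v t) := by
  have hne : ∀ u : List ℕ, u.length ≤ v.length → u ≠ [] → maxTree v u ≠ [] := by
    intro u hu hu'
    rw [← List.length_pos_iff, length_maxTree hu]
    exact List.length_pos_iff.2 hu'
  have hgetD : ∀ i, v.getD i 0 ≤ v.getLastD 0 := by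
    intro i
    by_cases hi : i < v.length
    · rw [List.getD_eq_getElem _ _ hi]
      exact getElem_le_getLastD hv hi
    · rw [List.getD_eq_default _ _ (by omega)]
      exact Nat.zero_le _
  rcases h with ⟨rfl, ht'⟩ | ⟨hs', ht', h⟩
  · refine Or.inl ⟨by simp [maxTree], hne t ht ht'⟩
  · have hps := List.length_pos_iff.2 hs'
    have hpt := List.length_pos_iff.2 ht'
    have hs1 := hgetD (s.length - 1)
    refine Or.inr ⟨hne s hs hs', hne t ht ht', ?_⟩
    rw [getLastD_maxTree hs' hs, getLastD_maxTree ht' ht]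
    rcases h with h | ⟨h, hlt⟩
    · left
      split_ifs <;> omega
    · have hlt' := maxTree_lt hv hs ht hlt
      rw [h]
      by_cases h0 : t.getLastD 0 = 0
      · rw [if_pos h0, if_pos h0]
        -- Both sequences consist of zeros, so the lexicographically smaller one is the shorter.
        have hlen : s.length ≤ t.length := by
          by_contra! hcon
          have h1 := eq_replicate_of_getLastD_eq_zero hsm (h.trans h0)
          have h2 := eq_replicate_of_getLastD_eq_zero htm h0
          have h3 : t <+: s := by
            rw [h1, h2, List.prefix_replicate_iff]
            simp [hcon.le]
          exact lt_asymm hlt (lt_of_initSeg ⟨h3, fun h => by rw [h] at hcon; omega⟩)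
        have hle : v.getD (s.length - 1) 0 ≤ v.getD (t.length - 1) 0 := by
          rw [List.getD_eq_getElem _ _ (by omega), List.getD_eq_getElem _ _ (by omega)]
          rcases Nat.lt_or_eq_of_le (Nat.sub_le_sub_right hlen 1) with h1 | h1
          · exact List.pairwise_iff_getElem.1 hv _ _ _ _ h1
          · simp [h1]
        exact hle.lt_or_eq.imp_right fun h1 => ⟨h1, hlt'⟩
      · rw [if_neg h0, if_neg h0]
        exact Or.inr ⟨rfl, hlt'⟩

section

variable {k : ℕ}

theorem Xmax_mem_Ellentuck (v : Ome k) : Xmax v ∈ Ellentuck k := by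
  have hlen : ∀ t : Omle k, t.1.length ≤ v.1.length := fun t => t.2.2.trans_eq v.2.2.symm
  refine ⟨fun t => ⟨maxTree v.1 t.1, pairwise_maxTree v.2.1 t.2.1,
    (length_maxTree (hlen t)).trans_le t.2.2⟩, ⟨fun s t h => ?_, fun s t h => ⟨?_, fun heq => ?_⟩⟩,
    ?_⟩
  · exact maxTree_prec v.2.1 s.2.1 t.2.1 (hlen s) (hlen t) h
  · obtain ⟨u, hu⟩ := h.1
    change maxTree v.1 s.1 <+: maxTree v.1 t.1
    rw [List.prefix_iff_getElem]
    refine ⟨by rw [length_maxTree (hlen s), length_maxTree (hlen t)]; exact h.1.length_le,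
      fun i hi => ?_⟩
    rw [length_maxTree (hlen s)] at hi
    simp only [maxTree, List.getElem_zipWith, h.1.getElem hi]
  · have h1 := congrArg List.length heq
    simp only [length_maxTree (hlen s), length_maxTree (hlen t)] at h1
    exact h.2 (h.1.eq_of_length h1)
  · ext w
    exact exists_congr fun u => ⟨fun h => Subtype.ext h, fun h => congrArg Subtype.val h⟩

theorem maxTree_replicate_zero (v : List ℕ) : maxTree v (List.replicate v.length 0) = v := by
  apply List.ext_getElem
  · simp [maxTree]
  · intro i h1 h2
    simp [maxTree]

theorem self_mem_Xmax (v : Ome k) : v ∈ Xmax v :=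
  ⟨⟨List.replicate k 0, by simp [List.pairwise_replicate], by simp⟩, by
    simpa only [v.2.2] using maxTree_replicate_zero v.1⟩

/-- The last term of `maxTree v u` is the sum of the two last terms, even when that of `u` is `0`.
This composition law makes the sets `X_v^max` nested. -/
theorem maxTree_maxTree {v u t : List ℕ} (hu : u.length = v.length) (hne : u ≠ []) :
    maxTree (maxTree v u) t = maxTree v (maxTree u t) := by
  have hlast : (maxTree v u).getLastD 0 = v.getLastD 0 + u.getLastD 0 := by
    rw [getLastD_maxTree hne hu.le]
    split_ifs with h
    · have hv : v ≠ [] := by rintro rfl; exact hne (List.length_eq_zero_iff.1 hu)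
      have := List.length_pos_iff.2 hv
      rw [h, add_zero, getLastD_eq_getElem hv, List.getD_eq_getElem _ _ (by omega)]
      simp [hu]
    · rfl
  apply List.ext_getElem
  · simp [maxTree, min_assoc]
  · intro i h1 h2
    have h : maxTree (maxTree v u) t = List.zipWith
        (fun n m => if m = 0 then n else v.getLastD 0 + u.getLastD 0 + m) (maxTree v u) t := by
      rw [← hlast]
      rfl
    simp only [h, List.getElem_zipWith]
    simp only [maxTree, List.getElem_zipWith]
    split_ifs <;> omega

theorem Xmax_subset (hk : 0 < k) {v w : Ome k} (h : w ∈ Xmax v) : Xmax w ⊆ Xmax v := by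
  rintro z ⟨u', hu'⟩
  obtain ⟨u, hu⟩ := h
  have hne : u.1 ≠ [] := List.ne_nil_of_length_pos (by rw [u.2.2]; exact hk)
  refine ⟨⟨maxTree u.1 u'.1, pairwise_maxTree u.2.1 u'.2.1, ?_⟩, ?_⟩
  · rw [length_maxTree (by rw [u.2.2, u'.2.2]), u'.2.2]
  · rw [← hu', ← hu, maxTree_maxTree (by rw [u.2.2, v.2.2]) hne]

/-- A parameter sequence ending in `0` is identically zero and returns `v`; any other adds its
positive last term to that of `v`. -/
theorem le_of_mem_Xmax {v w : Ome k} (h : w ∈ Xmax v) : w = v ∨ v.last < w.last := by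
  obtain ⟨u, hu⟩ := h
  by_cases h0 : u.1.getLastD 0 = 0
  · left
    apply Subtype.ext
    rw [← hu, eq_replicate_of_getLastD_eq_zero u.2.1 h0, u.2.2]
    simpa only [v.2.2] using maxTree_replicate_zero v.1
  · right
    have hne : u.1 ≠ [] := by intro h; simp [h] at h0
    unfold Ome.last
    rw [← hu, getLastD_maxTree hne (by rw [u.2.2, v.2.2]), if_neg h0]
    omega

/-- The part of `X_v^max` below `w`. -/
noncomputable def segment (v w : Ome k) : Finset (Ome k) :=
  Set.Finite.toFinset (s := {z | z ∈ Xmax v ∧ z.lt w})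
    (w.finite_setOf_lt.subset fun _ h => h.2)

theorem mem_segment {v w z : Ome k} : z ∈ segment v w ↔ z ∈ Xmax v ∧ z.lt w := by
  simp [segment]

/-- A finite `≺`-initial part of a member of `𝓔_k` is an approximation once it is nonempty, and here
it contains `v`. -/
theorem segment_mem_Approx {v w : Ome k} (h : v.lt w) : segment v w ∈ Approx k :=
  ⟨⟨v, mem_segment.2 ⟨self_mem_Xmax v, h⟩⟩, _, rfl, Xmax v, Xmax_mem_Ellentuck v,
    fun _ hz => (mem_segment.1 hz).1,
    fun _ hz _ hy hyz => mem_segment.2 ⟨hy, Ome.lt_trans hyz (mem_segment.1 hz).2⟩⟩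

end

/-! ### Small approximations with prescribed last terms -/

/-- The number of sequences of length at most `k` that are `≺`-below `s`. -/
noncomputable def precRank (k : ℕ) (s : List ℕ) : ℕ :=
  {t : List ℕ | (t.Pairwise (· ≤ ·) ∧ t.length ≤ k) ∧ Prec t s}.ncard

theorem precRank_lt {k : ℕ} {s t : List ℕ} (hs : s.Pairwise (· ≤ ·) ∧ s.length ≤ k)
    (h : Prec s t) : precRank k s < precRank k t :=
  Set.ncard_lt_ncard ⟨fun _ hu => ⟨hu.1, prec_trans hu.2 h⟩,
    fun hsub => prec_irrefl s (hsub ⟨hs, h⟩).2⟩ (finite_setOf_prec k t)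

theorem Ome.lt_iff_precRank_lt {k : ℕ} {v w : Ome k} :
    v.lt w ↔ precRank k v.1 < precRank k w.1 := by
  refine ⟨precRank_lt v.toOmle.2, fun h => ?_⟩
  rcases prec_trichotomy v.1 w.1 with h1 | h1 | h1
  · exact h1
  · rw [h1] at h
    exact absurd h (Nat.lt_irrefl _)
  · exact absurd h (precRank_lt w.toOmle.2 h1).not_gt

/-- Initial segments are finite and the constant sequences are infinitely many, so `≺` has order
type `ω` and the members can be listed by increasing rank. -/
theorem exists_enumeration {k : ℕ} (hk : 0 < k) :
    ∃ e : ℕ → Ome k, (∀ i j, (e i).lt (e j) ↔ i < j) ∧ Function.Surjective e := by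
  have hinj : Function.Injective fun v : Ome k => precRank k v.1 := by
    intro v w h
    rcases prec_trichotomy v.1 w.1 with h1 | h1 | h1
    · exact absurd h (precRank_lt v.toOmle.2 h1).ne
    · exact Subtype.ext h1
    · exact absurd h (precRank_lt w.toOmle.2 h1).ne'
  have : Infinite (Ome k) := by
    refine Infinite.of_injective (fun n : ℕ => (⟨List.replicate k n, by
      simp [List.pairwise_replicate], by simp⟩ : Ome k)) fun m n h => ?_
    have h1 : List.replicate k m = List.replicate k n := congrArg Subtype.val h
    rcases List.replicate_inj.1 h1 with ⟨-, h2⟩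
    exact h2.resolve_left hk.ne'
  have hinf : {n | ∃ v : Ome k, precRank k v.1 = n}.Infinite :=
    Set.infinite_range_of_injective hinj
  choose e he using fun n => Nat.nth_mem_of_infinite hinf n
  have hlt : ∀ i j, (e i).lt (e j) ↔ i < j := by
    intro i j
    rw [Ome.lt_iff_precRank_lt, he, he]
    exact (Nat.nth_strictMono hinf).lt_iff_lt
  refine ⟨e, hlt, fun v => ?_⟩
  have : precRank k v.1 ∈ Set.range (Nat.nth fun n => ∃ v : Ome k, precRank k v.1 = n) := by
    rw [Nat.range_nth_of_infinite hinf]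
    exact ⟨v, rfl⟩
  obtain ⟨n, hn⟩ := this
  exact ⟨n, hinj ((he n).trans hn)⟩

/-- The members of `𝓐𝓡_m^k`, `m ≤ d`, realize every non-decreasing sequence of last terms up to a
bounded error. -/
theorem exists_approx_near {k : ℕ} (hk : 0 < k) (d : ℕ) :
    ∃ M : ℕ, ∀ m ≤ d, ∀ A : ℕ → ℕ, Monotone A → ∃ u : Fin m → Ome k,
      (∃ U ∈ ApproxN k m, ∀ w, w ∈ U ↔ ∃ l, u l = w) ∧
        ∀ l : Fin m, A l < (u l).last ∧ (u l).last < A l + M := by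
  classical
  obtain ⟨e, he, hesurj⟩ := exists_enumeration hk
  -- The error will be the rank of one of the first `d` members, which is below the rank of `e d`.
  refine ⟨precRank k (e d).1, fun m hmd A hA => ?_⟩
  have heinj : Function.Injective e := by
    intro i j h
    rcases lt_trichotomy i j with h1 | h1 | h1
    · exact absurd (h ▸ (he i j).2 h1) (Ome.lt_irrefl _)
    · exact h1
    · exact absurd (h ▸ (he j i).2 h1) (Ome.lt_irrefl _)
  have hfin : ∀ s, {t : ℕ | Prec (e t).1 s}.Finite := by
    intro s
    refine Set.Finite.of_finite_image (f := fun t => (e t).1) ((finite_setOf_prec k s).subset ?_)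
      (fun i _ j _ h => heinj (Subtype.ext h))
    rintro _ ⟨t, ht, rfl⟩
    exact ⟨(e t).toOmle.2, ht⟩
  -- `idx` extends the position in the enumeration `e` to sequences of every length, so that shorter
  -- nodes of the tree can be labelled too.
  set idx : List ℕ → ℕ := fun s => {t : ℕ | Prec (e t).1 s}.ncard with hidx
  have hidxe : ∀ l, idx (e l).1 = l := by
    intro l
    have : {t : ℕ | Prec (e t).1 (e l).1} = (Finset.range l : Set ℕ) := by
      ext t
      rw [Finset.coe_range]
      exact he t l
    rw [hidx]
    simp only [this, Set.ncard_coe_finset, Finset.card_range]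
  -- `A ∘ idx` is only weakly monotone; adding the rank makes the labels strictly `≺`-monotone.
  set g : List ℕ → ℕ := fun s => A (idx s) + precRank k s
  have hg : PrecMono k g := by
    intro s t h
    exact add_lt_add_of_le_of_lt
      (hA (Set.ncard_le_ncard (fun _ hu => prec_trans hu h) (hfin t.1))) (precRank_lt s.2 h)
  have hne : ∀ v : Ome k, v.1 ≠ [] := fun v =>
    List.ne_nil_of_length_pos (by rw [v.2.2]; exact hk)
  set T : Ome k → Ome k := fun v => ⟨labelSeq g v.1, hg.pairwise_labelSeq v.toOmle,
    (length_labelSeq g v.1).trans v.2.2⟩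
  have hTlast : ∀ v : Ome k, (T v).last = A (idx v.1) + precRank k v.1 := fun v =>
    getLastD_labelSeq g (hne v)
  have hTlt : ∀ v w : Ome k, v.lt w → (T v).lt (T w) := fun v w h =>
    (isEllentuckTree_labelTree hg).1 v.toOmle w.toOmle h
  have hTe : ∀ i j, (T (e i)).lt (T (e j)) → i < j := by
    intro i j h
    by_contra! hcon
    rcases hcon.eq_or_lt with rfl | h1
    · exact Ome.lt_irrefl _ h
    · exact Ome.lt_irrefl _ (Ome.lt_trans h (hTlt _ _ ((he j i).2 h1)))
  refine ⟨fun l => T (e l), ⟨Finset.univ.image fun l : Fin m => T (e l), ⟨?_,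
    {v | ∃ u : Ome k, labelTree hg u.toOmle = v.toOmle},
    ⟨_, isEllentuckTree_labelTree hg, rfl⟩, ?_, ?_⟩, fun w => by simp⟩, fun l => ?_⟩
  · rw [Finset.card_image_of_injective, Finset.card_univ, Fintype.card_fin]
    intro i j (h : T (e i) = T (e j))
    rcases lt_trichotomy i j with h1 | h1 | h1
    · exact absurd (hTlt _ _ ((he i j).2 h1)) (h ▸ Ome.lt_irrefl _)
    · exact h1
    · exact absurd (hTlt _ _ ((he j i).2 h1)) (h ▸ Ome.lt_irrefl _)
  · intro v hv
    obtain ⟨l, -, rfl⟩ := Finset.mem_image.1 hv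
    exact ⟨e l, rfl⟩
  · rintro v hv w ⟨u, hu⟩ hwv
    obtain ⟨l, -, rfl⟩ := Finset.mem_image.1 hv
    obtain ⟨t, rfl⟩ := hesurj u
    have hw : w = T (e t) := Subtype.ext (congrArg (fun z : Omle k => z.1) hu.symm)
    subst hw
    exact Finset.mem_image.2 ⟨⟨t, (hTe _ _ hwv).trans l.2⟩, Finset.mem_univ _, rfl⟩
  · have h1 : precRank k [] < precRank k (e l).1 :=
      precRank_lt ⟨List.Pairwise.nil, Nat.zero_le _⟩ (Or.inl ⟨rfl, hne _⟩)
    have h2 : precRank k (e l).1 < precRank k (e d).1 :=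
      precRank_lt (e l).toOmle.2 ((he l d).2 (l.2.trans_le hmd))
    simp only [hTlast, hidxe]
    omega

/-! ### The lower estimate -/

section

variable {k d : ℕ} {θ : ℝ} {x : ℕ → Ome k →₀ ℝ} {v : ℕ → Ome k}

theorem Successive.tNorm_sum_mono (hx : Successive x) (h0 : 0 ≤ θ) (h1 : θ ≤ 1) (a : ℕ → ℝ)
    {W W' : Finset ℕ} (hW : W ⊆ W') :
    tNorm k d θ (∑ i ∈ W, a i • x i) ≤ tNorm k d θ (∑ i ∈ W', a i • x i) := by
  refine tNorm_le_of_abs_le h0 h1 fun w => ?_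
  by_cases hw : ∃ i ∈ W, w ∈ (x i).support
  · obtain ⟨i, hi, hwi⟩ := hw
    rw [hx.sum_apply_of_mem a hi hwi, hx.sum_apply_of_mem a (hW hi) hwi]
  · push Not at hw
    rw [sum_apply_of_notMem a hw, abs_zero]
    exact abs_nonneg _

theorem abs_le_tNorm_smul (h0 : 0 ≤ θ) (h1 : θ ≤ 1) {y : Ome k →₀ ℝ} (hy : tNorm k d θ y = 1)
    (a : ℝ) : |a| ≤ tNorm k d θ (a • y) := by
  rcases eq_or_ne a 0 with rfl | ha
  · rw [abs_zero]
    exact tNorm_nonneg _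
  · have h := tNorm_smul_le (k := k) (d := d) h0 h1 a⁻¹ (a • y)
    rw [smul_smul, inv_mul_cancel₀ ha, one_smul, hy, abs_inv] at h
    have hpos := abs_pos.2 ha
    rwa [inv_mul_eq_div, le_div_iff₀ hpos, one_mul] at h

theorem strictMono_last (hvlt : ∀ i, (v i).lt (v (i + 1))) (hv : ∀ i, v (i + 1) ∈ Xmax (v i)) :
    StrictMono fun i => (v i).last := by
  refine strictMono_nat_of_lt_succ fun i => ?_
  rcases le_of_mem_Xmax (hv i) with h | h
  · exact absurd (hvlt i) (h ▸ Ome.lt_irrefl _)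
  · exact h

/-- A piece with extreme indices `p` and `q` is captured by the part of `X_{v_p}^max` below
`v_{q+1}`. As the last terms of the `v i` increase strictly, index gaps turn into gaps of at least
`M` between last terms, and these leave room for separating points known only up to the error `M`.
-/
theorem splitting_of_separated (hk : 0 < k) (h0 : 0 ≤ θ) (h1 : θ ≤ 1) {M : ℕ}
    (hM : ∀ m ≤ d, ∀ A : ℕ → ℕ, Monotone A → ∃ u : Fin m → Ome k, (∃ U ∈ ApproxN k m,
      ∀ w, w ∈ U ↔ ∃ l, u l = w) ∧ ∀ l : Fin m, A l < (u l).last ∧ (u l).last < A l + M)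
    (hx : Successive x) (hlt : ∀ i, LTPoint (x i).support (v (i + 1)))
    (hsupp : ∀ i, ∀ w ∈ (x i).support, w ∈ Xmax (v i)) (hv : ∀ i, v (i + 1) ∈ Xmax (v i))
    (hlast : StrictMono fun i => (v i).last) {a : ℕ → ℝ} {W : Finset ℕ}
    (hWM : ∀ i ∈ W, M ≤ i) (hWsep : ∀ i ∈ W, ∀ i' ∈ W, i < i' → i + 1 + M ≤ i') {χ : ℕ → ℕ}
    (hχ : MonotoneOn χ W) (hχd : ∀ i ∈ W, χ i < d) :
    θ * ∑ c ∈ Finset.range d, tNorm k d θ (∑ i ∈ W.filter (χ · = c), a i • x i) ≤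
      tNorm k d θ (∑ i ∈ W, a i • x i) := by
  classical
  have hvle : ∀ i j, i ≤ j → (v i).le (v j) := by
    intro i j hij
    rcases hij.eq_or_lt with rfl | h
    · exact Or.inl rfl
    · exact Or.inr (prec_of_last_lt (hlast h))
  have hXmax : ∀ i j, i ≤ j → Xmax (v j) ⊆ Xmax (v i) := fun i j hij =>
    antitone_nat_of_succ_le (f := fun i => Xmax (v i)) (fun n => Xmax_subset hk (hv n)) hij
  -- the colours in use and the corresponding pieces
  set P := W.image χ with hP
  have hPd : P ⊆ Finset.range d := by
    intro c hc
    obtain ⟨i, hi, rfl⟩ := Finset.mem_image.1 hc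
    exact Finset.mem_range.2 (hχd i hi)
  have hcard : P.card ≤ d := by simpa using Finset.card_le_card hPd
  have hsum : ∑ c ∈ Finset.range d, tNorm k d θ (∑ i ∈ W.filter (χ · = c), a i • x i) =
      ∑ c ∈ P, tNorm k d θ (∑ i ∈ W.filter (χ · = c), a i • x i) := by
    refine (Finset.sum_subset hPd fun c _ hc => ?_).symm
    rw [Finset.filter_eq_empty_iff.2 fun i hi h => hc (Finset.mem_image.2 ⟨i, hi, h⟩),
      Finset.sum_empty, tNorm_zero h0 h1]
  rcases Nat.eq_zero_or_pos P.card with hP0 | hPpos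
  · rw [hsum, Finset.card_eq_zero.1 hP0, Finset.sum_empty, mul_zero]
    exact tNorm_nonneg _
  set φ := P.orderEmbOfFin rfl with hφ
  have hpiece : ∀ l, ∃ p q, p ∈ W ∧ q ∈ W ∧ χ p = φ l ∧ χ q = φ l ∧
      ∀ i ∈ W, χ i = φ l → p ≤ i ∧ i ≤ q := by
    intro l
    have hne : (W.filter (χ · = φ l)).Nonempty := by
      obtain ⟨i, hi, hil⟩ := Finset.mem_image.1 (P.orderEmbOfFin_mem rfl l)
      exact ⟨i, Finset.mem_filter.2 ⟨hi, hil⟩⟩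
    have hmin := Finset.mem_filter.1 (Finset.min'_mem _ hne)
    have hmax := Finset.mem_filter.1 (Finset.max'_mem _ hne)
    exact ⟨_, _, hmin.1, hmax.1, hmin.2, hmax.2, fun i hi hil =>
      ⟨Finset.min'_le _ _ (Finset.mem_filter.2 ⟨hi, hil⟩),
        Finset.le_max' _ _ (Finset.mem_filter.2 ⟨hi, hil⟩)⟩⟩
  choose p q hpW hqW hpφ hqφ hpq using hpiece
  have hgap : ∀ l l', l < l' → q l + 1 + M ≤ p l' := by
    intro l l' hll
    refine hWsep _ (hqW l) _ (hpW l') ?_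
    by_contra! hcon
    have h2 := hχ (hpW l') (hqW l) hcon
    rw [hpφ, hqφ] at h2
    exact h2.not_gt (φ.strictMono hll)
  -- the separating points
  set A : ℕ → ℕ := fun n => (Finset.univ.filter fun l : Fin P.card => l.val < n).sup
    fun l => (v (q l + 1)).last with hA
  have hAmono : Monotone A := fun m n hmn => Finset.sup_mono fun l hl =>
    Finset.mem_filter.2 ⟨Finset.mem_univ _, (Finset.mem_filter.1 hl).2.trans_le hmn⟩
  obtain ⟨u, ⟨U, hU, hUu⟩, hu⟩ := hM P.card hcard A hAmono
  have hAle : ∀ l : Fin P.card, A l + M ≤ (v (p l)).last := by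
    intro l
    -- For the first piece the supremum is empty, and the room comes from `M ≤ i` on `W`.
    have hMl : M ≤ (v (p l)).last := (hWM _ (hpW l)).trans (hlast.id_le _)
    have : A l ≤ (v (p l)).last - M := by
      refine Finset.sup_le fun l' hl' => ?_
      have h2 := hgap l' l (Finset.mem_filter.1 hl').2
      have h3 : M + (v (q l' + 1)).last ≤ (v (M + (q l' + 1))).last := hlast.add_le_nat _ _
      have h4 : (v (M + (q l' + 1))).last ≤ (v (p l)).last := hlast.monotone (by omega)
      omega
    omega
  have hAge : ∀ l l' : Fin P.card, l < l' → (v (q l + 1)).last ≤ A l' := fun l l' h =>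
    Finset.le_sup (f := fun l => (v (q l + 1)).last)
      (Finset.mem_filter.2 ⟨Finset.mem_univ l, h⟩)
  have hadm : Admissible k d fun l => segment (v (p l)) (v (q l + 1)) := by
    refine ⟨fun l => segment_mem_Approx (prec_of_last_lt (hlast ?_)), u, ?_, ?_, ?_⟩
    · have := (hpq l _ (hpW l) (hpφ l)).2
      omega
    · refine ⟨P.card, hPpos, hcard, ?_⟩
      have : Finset.univ.image u = U := by
        ext w
        simp [hUu]
      convert hU
    · intro l w hw
      refine Or.inr (prec_of_last_lt ?_)
      have h2 : (v (p l)).last ≤ w.last := by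
        rcases le_of_mem_Xmax (mem_segment.1 hw).1 with h | h
        exacts [h ▸ le_rfl, h.le]
      change (u l).last < w.last
      have := hu l
      have := hAle l
      omega
    · intro l l' hll w hw
      refine prec_of_last_lt ?_
      have h2 : w.last ≤ (v (q l + 1)).last := Prec.last_le (mem_segment.1 hw).2
      change w.last < (u l').last
      have := hu l'
      have := hAge l l' hll
      omega
  have hsum' : ∑ c ∈ P, tNorm k d θ (∑ i ∈ W.filter (χ · = c), a i • x i) =
      ∑ l, tNorm k d θ (∑ i ∈ W.filter (χ · = φ l), a i • x i) := by
    conv_lhs => rw [← P.map_orderEmbOfFin_univ rfl]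
    rw [Finset.sum_map]
    rfl
  rw [hsum, hsum']
  refine le_trans (mul_le_mul_of_nonneg_left (Finset.sum_le_sum fun l _ => ?_) h0)
    (sum_tNorm_restr_le h0 h1 (∑ i ∈ W, a i • x i) hPpos hcard hadm)
  refine tNorm_le_of_abs_le h0 h1 fun w => ?_
  by_cases hw : ∃ i ∈ W.filter (χ · = φ l), w ∈ (x i).support
  · obtain ⟨i, hi, hwi⟩ := hw
    obtain ⟨hiW, hil⟩ := Finset.mem_filter.1 hi
    obtain ⟨h2, h3⟩ := hpq l i hiW hil
    have hmem : w ∈ segment (v (p l)) (v (q l + 1)) := mem_segment.2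
      ⟨hXmax _ _ h2 (hsupp i w hwi),
        Ome.lt_of_lt_of_le (hlt i w hwi) (hvle _ _ (by omega))⟩
    rw [restr_apply_of_mem hmem, hx.sum_apply_of_mem a hi hwi, hx.sum_apply_of_mem a hiW hwi]
  · push Not at hw
    rw [sum_apply_of_notMem a hw, abs_zero]
    exact abs_nonneg _

/-- Two indices in one residue class modulo `M + 1` have the gap needed in `splitting_of_separated`.
The finitely many indices below `M` are controlled one at a time by monotonicity of the norm. -/
theorem exists_le_tNorm_sum {r : ℝ} (hk : 0 < k) (h0 : 0 ≤ θ) (h1 : θ ≤ 1) (hd : 2 ≤ d)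
    (hr : 1 < r) (hdθ : (d : ℝ) * θ = (d : ℝ) ^ (1 / r)) (hx : Successive x)
    (hnorm : ∀ i, tNorm k d θ (x i) = 1) (hlt : ∀ i, LTPoint (x i).support (v (i + 1)))
    (hsupp : ∀ i, ∀ w ∈ (x i).support, w ∈ Xmax (v i)) (hv : ∀ i, v (i + 1) ∈ Xmax (v i))
    (hvlt : ∀ i, (v i).lt (v (i + 1))) :
    ∃ C : ℝ, 0 < C ∧ ∀ (s : Finset ℕ) (a : ℕ → ℝ),
      (∑ i ∈ s, |a i| ^ r) ^ (1 / r) ≤ C * tNorm k d θ (∑ i ∈ s, a i • x i) := by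
  classical
  obtain ⟨M, hM⟩ := exists_approx_near hk d
  have hr0 : 0 < r := by linarith
  have hd0 : (0 : ℝ) < d := by exact_mod_cast (by omega : 0 < d)
  have hd1 : (2 : ℝ) ≤ d := by exact_mod_cast hd
  -- The `M + 1` residue classes contribute at most `(2 * d * N s) ^ r` each, and the small indices
  -- together no more than all the classes; hence the factor `2 * (M + 1)`.
  refine ⟨(2 * (M + 1 : ℕ) : ℝ) ^ (1 / r) * (2 * d), by positivity, fun s a => ?_⟩
  set N : Finset ℕ → ℝ := fun W => tNorm k d θ (∑ i ∈ W, a i • x i) with hN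
  have hN0 : ∀ W, 0 ≤ N W := fun W => tNorm_nonneg _
  have hNmono : ∀ W W', W ⊆ W' → N W ≤ N W' := fun W W' h => hx.tNorm_sum_mono h0 h1 a h
  have hN1 : ∀ i, |a i| ≤ N {i} := fun i => by
    simpa [hN] using abs_le_tNorm_smul h0 h1 (hnorm i) (a i)
  set Q := (2 * d * N s) ^ r with hQ
  have hclass : ∀ c ∈ Finset.range (M + 1),
      ∑ i ∈ (s.filter fun i => M ≤ i).filter (fun i => i % (M + 1) = c), |a i| ^ r ≤ Q := by
    intro c _
    set W := (s.filter fun i => M ≤ i).filter (fun i => i % (M + 1) = c) with hW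
    have hWs : W ⊆ s := (Finset.filter_subset _ _).trans (Finset.filter_subset _ _)
    refine (sum_rpow_le_of_splitting (b := fun i => |a i|) (N := N) hd hr hdθ
      (fun i => abs_nonneg _) hN0 (fun W' hW' => hNmono _ _ hW') (fun i _ => hN1 i)
      fun W' hW' χ hχ hχd => ?_).trans ?_
    · refine splitting_of_separated hk h0 h1 hM hx hlt hsupp hv (strictMono_last hvlt hv)
        (fun i hi => ?_) (fun i hi i' hi' hii => ?_) hχ hχd
      · exact (Finset.mem_filter.1 (Finset.mem_filter.1 (hW' hi)).1).2
      · have h2 := (Finset.mem_filter.1 (hW' hi)).2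
        have h3 := (Finset.mem_filter.1 (hW' hi')).2
        have h4 : (M + 1) ∣ i' - i := (Nat.modEq_iff_dvd' hii.le).1 (h2.trans h3.symm)
        have h5 := Nat.le_of_dvd (by omega) h4
        omega
    · have := hN0 W
      exact Real.rpow_le_rpow (by positivity)
        (mul_le_mul_of_nonneg_left (hNmono _ _ hWs) (by positivity)) hr0.le
  have hlarge : ∑ i ∈ s.filter (fun i => M ≤ i), |a i| ^ r ≤ (M + 1 : ℕ) * Q := by
    rw [← Finset.sum_fiberwise_of_maps_to (g := fun i => i % (M + 1)) (t := Finset.range (M + 1))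
      fun i _ => Finset.mem_range.2 (Nat.mod_lt _ (Nat.succ_pos M))]
    refine (Finset.sum_le_card_nsmul _ _ _ hclass).trans (le_of_eq ?_)
    rw [Finset.card_range, nsmul_eq_mul]
  have hsmall : ∑ i ∈ s.filter (fun i => ¬ M ≤ i), |a i| ^ r ≤ (M + 1 : ℕ) * Q := by
    have hterm : ∀ i ∈ s.filter (fun i => ¬ M ≤ i), |a i| ^ r ≤ Q := by
      intro i hi
      have h2 := (hN1 i).trans
        (hNmono _ _ (Finset.singleton_subset_iff.2 (Finset.mem_filter.1 hi).1))
      have h3 := hN0 s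
      exact Real.rpow_le_rpow (abs_nonneg _) (by nlinarith) hr0.le
    refine (Finset.sum_le_card_nsmul _ _ _ hterm).trans ?_
    rw [nsmul_eq_mul]
    refine mul_le_mul_of_nonneg_right ?_ (Real.rpow_nonneg (mul_nonneg (by positivity) (hN0 s)) _)
    have : s.filter (fun i => ¬ M ≤ i) ⊆ Finset.range (M + 1) := by
      intro i hi
      have := (Finset.mem_filter.1 hi).2
      rw [Finset.mem_range]
      omega
    have := Finset.card_le_card this
    rw [Finset.card_range] at this
    exact_mod_cast this
  have htot : ∑ i ∈ s, |a i| ^ r ≤ 2 * (M + 1 : ℕ) * Q := by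
    rw [← Finset.sum_filter_add_sum_filter_not s fun i => M ≤ i]
    linarith
  have hQ0 : 0 ≤ 2 * d * N s := mul_nonneg (by positivity) (hN0 s)
  calc (∑ i ∈ s, |a i| ^ r) ^ (1 / r) ≤ (2 * (M + 1 : ℕ) * Q) ^ (1 / r) :=
        Real.rpow_le_rpow (Finset.sum_nonneg fun i _ => Real.rpow_nonneg (abs_nonneg _) _) htot
          (by positivity)
    _ = (2 * (M + 1 : ℕ) : ℝ) ^ (1 / r) * (2 * d) * N s := by
        rw [Real.mul_rpow (by positivity) (Real.rpow_nonneg hQ0 _), ← Real.rpow_mul hQ0,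
          mul_one_div_cancel hr0.ne', Real.rpow_one, mul_assoc _ (2 * (d : ℝ))]

end

/-! ### Norms of finite combinations in the two spaces -/

theorem norm_sum_coe {k d : ℕ} {θ : Set.Ioo (0 : ℝ) 1} (x : ℕ → C00 k d θ) (a : ℕ →₀ ℝ) :
    ‖a.sum fun i r => r • (x i : TSpace k d θ)‖ =
      tNorm k d θ (∑ i ∈ a.support, a i • (id (x i) : Ome k →₀ ℝ)) := by
  have h : (a.sum fun i r => r • (x i : TSpace k d θ)) =
      ((∑ i ∈ a.support, a i • x i : C00 k d θ) : TSpace k d θ) := by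
    rw [← UniformSpace.Completion.coe_toComplL (𝕜 := ℝ), map_sum]
    simp only [map_smul]
    rfl
  rw [h, UniformSpace.Completion.norm_coe]
  rfl

theorem norm_sum_lpBasis {p : ENNReal} [Fact (1 ≤ p)] (hp : 0 < p.toReal) (a : ℕ →₀ ℝ) :
    ‖a.sum fun i r => r • lpBasis p i‖ =
      (∑ i ∈ a.support, |a i| ^ p.toReal) ^ (1 / p.toReal) := by
  have h : (a.sum fun i r => r • lpBasis p i) =
      ∑ i ∈ a.support, lp.single p i (a i) := by
    refine Finset.sum_congr rfl fun i _ => ?_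
    change a i • lp.single (E := fun _ : ℕ => ℝ) p i (1 : ℝ) = _
    rw [← lp.single_smul, smul_eq_mul, mul_one]
  have h2 := lp.norm_sum_single (E := fun _ : ℕ => ℝ) hp (fun i => a i) a.support
  rw [h]
  simp only [Real.norm_eq_abs] at h2
  rw [← h2, ← Real.rpow_mul (norm_nonneg _), mul_one_div_cancel hp.ne', Real.rpow_one]

end HighDimEllentuck

/-! ### The equivalence with the basis of `ℓ_p`. -/

theorem mainTheorem8 (k d : ℕ) (hk : 2 ≤ k) (θ : Set.Ioo (0 : ℝ) 1)
    (hdθ : 1 < (d : ℝ) * (θ : ℝ))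
    (p : ENNReal) [Fact (1 ≤ p)] (hp1 : 1 < p) (hptop : p ≠ ⊤)
    (hp : (d : ℝ) * (θ : ℝ) = (d : ℝ) ^ (1 / p.toReal))
    (x : ℕ → C00 k d θ) (hx : IsNormalizedBlockSeq x)
    (v : ℕ → Ome k)
    (hle : ∀ i, PointLE (v i) (x i).supp)
    (hlt : ∀ i, LTPoint (x i).supp (v (i + 1)))
    (hsupp : ∀ i, ∀ w ∈ (x i).supp, w ∈ Xmax (v i))
    (hv : ∀ i, v (i + 1) ∈ Xmax (v i)) :
    EquivalentSeq (fun i => (x i : TSpace k d θ)) (lpBasis p) := by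
  have h0 : (0 : ℝ) ≤ θ := θ.2.1.le
  have h1 : (θ : ℝ) ≤ 1 := θ.2.2.le
  have hr : 1 < p.toReal := by
    simpa using (ENNReal.toReal_lt_toReal ENNReal.one_ne_top hptop).2 hp1
  have hd : 2 ≤ d := by
    have h2 : (1 : ℝ) < d :=
      hdθ.trans_le (mul_le_of_le_one_right d.cast_nonneg h1)
    exact_mod_cast h2
  -- `C00` is a type synonym; `id` merely views its members as finitely supported functions.
  set y : ℕ → Ome k →₀ ℝ := fun i => id (x i) with hy
  have hnorm : ∀ i, tNorm k d θ (y i) = 1 := hx.1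
  have hvlt : ∀ i, (v i).lt (v (i + 1)) := by
    intro i
    have hne : (y i).support.Nonempty := by
      rw [Finsupp.support_nonempty_iff]
      intro h
      have := hnorm i
      rw [h, tNorm_zero h0 h1] at this
      exact zero_ne_one this
    obtain ⟨w, hw⟩ := hne
    exact Ome.lt_of_le_of_lt (hle i w hw) (hlt i w hw)
  have hlast := strictMono_last hvlt hv
  -- The increasing points `v i` lie between consecutive vectors and thus separate any two of them.
  have hsucc : Successive y := by
    intro i i' hii w hw w' hw'
    have h2 : (v (i + 1)).le (v i') := by
      rcases (Nat.succ_le_of_lt hii).eq_or_lt with h | h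
      · exact Or.inl (congrArg v h)
      · exact Or.inr (prec_of_last_lt (hlast h))
    exact Ome.lt_of_lt_of_le (Ome.lt_of_lt_of_le (hlt i w hw) h2) (hle i' w' hw')
  obtain ⟨C, hC, hupper⟩ := exists_tNorm_sum_le h0 h1 hd hr hp hsucc fun i => (hnorm i).le
  obtain ⟨c, hc, hlower⟩ := exists_le_tNorm_sum (by omega) h0 h1 hd hr hp hsucc hnorm hlt hsupp hv
    hvlt
  refine ⟨c⁻¹, inv_pos.2 hc, C, hC, fun a => ?_⟩
  rw [norm_sum_coe, norm_sum_lpBasis (by linarith)]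
  refine ⟨?_, hupper a.support a⟩
  rw [inv_mul_le_iff₀ hc]
  exact hlower a.support a
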